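/- Let $G$ be a finite group with the following property: any two non-linear irreducible complex characters $\chi,\psi$ of $G$ with $\chi(1)=\psi(1)$ are Galois conjugate, that is, there are a positive multiple $n$ of $|G|$ and an automorphism $\alpha\in\mathrm{Gal}(\mathbb{Q}_n|\mathbb{Q})$, where $\mathbb{Q}_n$ is the $n$-th cyclotomic field, such that $\psi(g)=\chi(g)^{\alpha}$ for all $g\in G$. Suppose that $G$ is solvable and not nilpotent, and let $K=G_\infty$ be the nilpotent residual of $G$, i.e. the smallest term of its lower central series. Then $G=KL$ is a Frobenius group with Frobenius kernel $K$ and Frobenius complement $L$ (so $K\cap L=1$), and either $L$ is cyclic or $L\cong Q_8$, the quaternion group of order $8$. -/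

import Mathlib

/-- `χ` is an irreducible complex character of `G`: the character of an irreducible
representation of `G` on some finite-dimensional complex vector space `ℂⁿ`. -/
def IsIrrChar (G : Type*) [Group G] (χ : G → ℂ) : Prop :=
  ∃ (n : ℕ) (ρ : Representation ℂ G (Fin n → ℂ)), ρ.IsIrreducible ∧ χ = ρ.character

/-- The `n`-th cyclotomic field `ℚ_n`, as the subfield of `ℂ` generated by the `n`-th roots of
unity. -/
noncomputable def cyclotomicSubfield (n : ℕ) : IntermediateField ℚ ℂ :=
  IntermediateField.adjoin ℚ {z : ℂ | z ^ n = 1}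

/-- `χ` and `ψ` are Galois conjugate: for some positive multiple `n` of `|G|`, they take values in
`ℚ_n` and some `α` in `Gal(ℚ_n | ℚ)` satisfies `ψ(g) = χ(g)^α` for all `g`. (For irreducible
characters the choice of `n` is immaterial.) -/
def GaloisConjugate {G : Type*} [Group G] (χ ψ : G → ℂ) : Prop :=
  ∃ n : ℕ, 0 < n ∧ Nat.card G ∣ n ∧
    ∃ α : cyclotomicSubfield n ≃ₐ[ℚ] cyclotomicSubfield n,
      ∀ g : G, ∃ z : cyclotomicSubfield n, (z : ℂ) = χ g ∧ (α z : ℂ) = ψ g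

/-- The class of GC*-groups: any two non-linear irreducible characters of the same degree are
Galois conjugate. The degree of a character `χ` is `χ 1`, and `χ` is linear if `χ 1 = 1`. -/
def IsGCStar (G : Type*) [Group G] : Prop :=
  ∀ χ ψ : G → ℂ, IsIrrChar G χ → IsIrrChar G ψ → χ 1 ≠ 1 → ψ 1 ≠ 1 → χ 1 = ψ 1 →
    GaloisConjugate χ ψ

/-- The intersection of the (descending) lower central series of `G`; for a finite group this is
its smallest term, the nilpotent residual. -/
def nilpotentResidual (G : Type*) [Group G] : Subgroup G :=
  ⨅ n : ℕ, (⊤ : Subgroup G).lowerCentralSeries n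

/-- The (finite) group `G` is a Frobenius group with Frobenius complement `L` and Frobenius
kernel `K`: `L` is a nontrivial proper subgroup meeting each conjugate `gLg⁻¹`, `g ∉ L`, trivially,
and `K` consists of `1` together with the elements lying in no conjugate of `L`. -/
structure IsFrobeniusGroup {G : Type*} [Group G] (K L : Subgroup G) : Prop where
  ne_bot : L ≠ ⊥
  ne_top : L ≠ ⊤
  inf_conj : ∀ g : G, g ∉ L → L ⊓ L.map (MulAut.conj g).toMonoidHom = ⊥
  mem_kernel : ∀ x : G, x ∈ K ↔ x = 1 ∨ ∀ g : G, x ∉ L.map (MulAut.conj g).toMonoidHom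

/-!
Two nonlinear irreducible characters of the same degree are Galois conjugate, so the rational
number `∑_{s ∈ S} χ(s)` attached to a subgroup `S` depends only on the degree of `χ`. Three
consequences drive the proof.

* Let a normal subgroup have a complement `M`. Characters induced from different extensions of a
  linear character `θ` of the normal subgroup have equal degrees but different sums over `M`, so
  that `θ` is fixed by `M` or has trivial stabilizer in `M`. This makes the order and the index of
  the residual `R` coprime, so `R` has a complement `L` by Schur–Zassenhaus. It also makes abelian
  subgroups of `L` act without fixed points on the nontrivial linear characters of `R`, whence they
  are cyclic.
* The nilpotent group `L` inherits the hypothesis. If it is not abelian, then it is a `p`-group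
  with cyclic abelian subgroups, hence generalized quaternion, and comparing the two-dimensional
  irreducible characters leaves only `Q₈`.
* If `t ∈ L` lies outside `L'` and is conjugate in `L` to all of `tL'`, then every nonlinear
  irreducible character vanishes at `t`, so the conjugacy class of `t` in `G` is the whole coset
  `tG'`. Thus `t` is conjugate to `tk` for all `k ∈ R`, which forces `t` to act on `R` without
  fixed points. The remaining elements `t ≠ 1` occur only for `L = Q₈`, where `t = i² = j²`; on the
  fixed points of `t` both `i` and `j` act by inversion, so `ij` would act trivially.
-/

section IrreducibleRepresentations

open Representation Module MonoidAlgebra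
open scoped commutatorElement

variable {G H k V W : Type*} [Group G] [Group H] [Field k] [AddCommGroup V] [Module k V]
  [AddCommGroup W] [Module k W] {ρ : Representation k G V}

theorem isIrreducible_iff_forall_stable (ρ : Representation k G V) :
    ρ.IsIrreducible ↔ Nontrivial V ∧ ∀ U : Submodule k V, (∀ g, ∀ v ∈ U, ρ g v ∈ U) →
      U = ⊥ ∨ U = ⊤ := by
  constructor
  · refine fun h => ⟨?_, fun U hU => ?_⟩
    · by_contra hV
      rw [not_nontrivial_iff_subsingleton] at hV
      exact (bot_ne_top (α := Subrepresentation ρ))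
        (Subrepresentation.toSubmodule_injective (Subsingleton.elim _ _))
    · exact (eq_bot_or_eq_top (⟨U, fun g _ hv => hU g _ hv⟩ : Subrepresentation ρ)).imp
        (congrArg Subrepresentation.toSubmodule) (congrArg Subrepresentation.toSubmodule)
  · rintro ⟨_, h⟩
    refine { exists_pair_ne := ⟨⊥, ⊤, fun e => ?_⟩, eq_bot_or_eq_top := fun U => ?_ }
    · exact bot_ne_top (congrArg Subrepresentation.toSubmodule e)
    · exact (h U.toSubmodule fun g _ hv => U.apply_mem_toSubmodule g hv).imp
        (Subrepresentation.toSubmodule_injective ·) (Subrepresentation.toSubmodule_injective ·)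

theorem nontrivial_of_isIrreducible (hρ : ρ.IsIrreducible) : Nontrivial V :=
  ((isIrreducible_iff_forall_stable ρ).1 hρ).1

theorem eq_bot_or_eq_top_of_stable (hρ : ρ.IsIrreducible) {U : Submodule k V}
    (hU : ∀ g, ∀ v ∈ U, ρ g v ∈ U) : U = ⊥ ∨ U = ⊤ :=
  ((isIrreducible_iff_forall_stable ρ).1 hρ).2 U hU

theorem isIrreducible_congr {σ : Representation k G W} (e : ρ.Equiv σ) (hρ : ρ.IsIrreducible) :
    σ.IsIrreducible := by
  have := nontrivial_of_isIrreducible hρ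
  refine (isIrreducible_iff_forall_stable σ).2
    ⟨e.toLinearEquiv.symm.toEquiv.nontrivial, fun U hU => ?_⟩
  have hstable : ∀ g, ∀ v ∈ U.comap e.toLinearEquiv.toLinearMap,
      ρ g v ∈ U.comap e.toLinearEquiv.toLinearMap := fun g v hv => by
    have h : e.toLinearEquiv (ρ g v) = σ g (e.toLinearEquiv v) :=
      IntertwiningMap.isIntertwining _ _ e.toIntertwiningMap g v
    rw [Submodule.mem_comap, LinearEquiv.coe_coe, h]
    exact hU g _ hv
  have hmap := Submodule.map_comap_eq_of_surjective e.toLinearEquiv.surjective U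
  rw [← hmap]
  exact (eq_bot_or_eq_top_of_stable hρ hstable).imp (fun h => by rw [h, Submodule.map_bot])
    fun h => by rw [h, Submodule.map_top, LinearEquiv.range]

theorem isIrreducible_comp {ρ : Representation k H V} (hρ : ρ.IsIrreducible) {f : G →* H}
    (hf : Function.Surjective f) : IsIrreducible (ρ.comp f : Representation k G V) :=
  (isIrreducible_iff_forall_stable _).2 ⟨nontrivial_of_isIrreducible hρ, fun _ hU =>
    eq_bot_or_eq_top_of_stable hρ fun g => by obtain ⟨g, rfl⟩ := hf g; exact hU g⟩

theorem exists_equiv_fin [FiniteDimensional k V] (ρ : Representation k G V) :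
    ∃ σ : Representation k G (Fin (finrank k V) → k), Nonempty (ρ.Equiv σ) :=
  let e := (finBasis k V).equivFun
  ⟨(e.conjRingEquiv : Module.End k V →* _).comp ρ, ⟨.mk e fun g => by ext; simp⟩⟩

theorem isIrrChar_character {V : Type*} [AddCommGroup V] [Module ℂ V] [FiniteDimensional ℂ V]
    {ρ : Representation ℂ G V} (hρ : ρ.IsIrreducible) : IsIrrChar G ρ.character := by
  obtain ⟨σ, ⟨e⟩⟩ := exists_equiv_fin ρ
  exact ⟨_, σ, isIrreducible_congr e hρ, char_iso e⟩

/-- The product `μ ⊗ ρ` of a representation with a linear character. -/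
def twist (ρ : Representation k G V) (μ : G →* kˣ) : Representation k G V where
  toFun g := (μ g : k) • ρ g
  map_one' := by simp
  map_mul' x y := by simp [smul_smul, mul_comm]

theorem twist_apply (ρ : Representation k G V) (μ : G →* kˣ) (g : G) :
    twist ρ μ g = (μ g : k) • ρ g := rfl

theorem character_twist (ρ : Representation k G V) (μ : G →* kˣ) (g : G) :
    (twist ρ μ).character g = μ g * ρ.character g := by
  simp [character, twist]

theorem isIrreducible_twist (hρ : ρ.IsIrreducible) (μ : G →* kˣ) : (twist ρ μ).IsIrreducible := by
  refine (isIrreducible_iff_forall_stable _).2 ⟨nontrivial_of_isIrreducible hρ, fun U hU =>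
    eq_bot_or_eq_top_of_stable hρ fun g v hv => ?_⟩
  simpa [twist_apply] using U.smul_mem (μ g : k)⁻¹ (hU g v hv)

theorem exists_apply_eq_smul_of_finrank_eq_one (ρ : Representation k G V) (h : finrank k V = 1) :
    ∃ μ : G →* kˣ, ∀ g v, ρ g v = (μ g : k) • v := by
  refine ⟨MonoidHom.toHomUnits (LinearMap.det.comp ρ), fun g v => ?_⟩
  obtain ⟨c, hc⟩ := ((ρ g).existsUnique_eq_smul_id_of_finrank_eq_one h).exists
  simp [hc, h]

/-- Schur's lemma for an endomorphism given as a plain linear map. -/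
theorem exists_eq_smul_of_commute [IsAlgClosed k] [FiniteDimensional k V] (hρ : ρ.IsIrreducible)
    {T : Module.End k V} (hT : ∀ g, Commute T (ρ g)) : ∃ c : k, T = c • 1 := by
  let f : IntertwiningMap ρ ρ := ⟨T, hT⟩
  obtain ⟨c, hc⟩ := (IsIrreducible.algebraMap_intertwiningMap_bijective_of_isAlgClosed (ρ := ρ)).2 f
  exact ⟨c, (congrArg IntertwiningMap.toLinearMap hc).symm⟩

theorem finrank_eq_one_of_apply_commutator [IsAlgClosed k] [FiniteDimensional k V]
    (hρ : ρ.IsIrreducible) (hc : ∀ x ∈ commutator G, ρ x = 1) : finrank k V = 1 := by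
  have hcomm : ∀ g x, Commute (ρ g) (ρ x) := fun g x => by
    have h : ρ ⁅g, x⁆ = 1 :=
      hc _ (Subgroup.commutator_mem_commutator (Subgroup.mem_top _) (Subgroup.mem_top _))
    rw [commute_iff_eq, ← map_mul, ← map_mul, show g * x = ⁅g, x⁆ * (x * g) by
      simp [commutatorElement_def, mul_assoc], map_mul, h, one_mul]
  have := nontrivial_of_isIrreducible hρ
  obtain ⟨v, hv⟩ := exists_ne (0 : V)
  have hstable : ∀ g, ∀ w ∈ k ∙ v, ρ g w ∈ k ∙ v := fun g w hw => by
    obtain ⟨c, hc⟩ := exists_eq_smul_of_commute hρ (hcomm g)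
    simpa [hc] using Submodule.smul_mem _ c hw
  have htop := (eq_bot_or_eq_top_of_stable hρ hstable).resolve_left
    fun h => hv (Submodule.span_singleton_eq_bot.1 h)
  rw [← finrank_top, ← htop, finrank_span_singleton hv]

theorem invariants_eq_bot_or_eq_top (hρ : ρ.IsIrreducible) (N : Subgroup G) [N.Normal] :
    invariants (ρ.comp N.subtype) = ⊥ ∨ invariants (ρ.comp N.subtype) = ⊤ :=
  eq_bot_or_eq_top_of_stable hρ (le_comap_invariants ρ N)

theorem norm_eq_zero_of_invariants_eq_bot [Fintype G] (h : invariants ρ = ⊥) : ρ.norm = 0 :=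
  LinearMap.ext fun v => (Submodule.mem_bot k).1 (h ▸ fun g => ρ.self_norm_apply g v)

theorem invariants_comp_subtype_eq_top_iff (ρ : Representation k G V) (S : Subgroup G) :
    invariants (ρ.comp S.subtype) = ⊤ ↔ ∀ s ∈ S, ρ s = 1 := by
  refine ⟨fun h s hs => LinearMap.ext fun v => ?_, fun h => eq_top_iff.2 fun v _ s => ?_⟩
  · exact (mem_invariants _ v).1 (h ▸ Submodule.mem_top) ⟨s, hs⟩
  · exact LinearMap.congr_fun (h s s.2) v

theorem isIrreducible_ofModule' (M : Type*) [AddCommGroup M] [Module k M] [Module k[G] M]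
    [IsScalarTower k k[G] M] [IsSimpleModule k[G] M] :
    (ofModule' M : Representation k G M).IsIrreducible := by
  refine (isIrreducible_iff_forall_stable _).2 ⟨IsSimpleModule.nontrivial k[G] M, fun U hU => ?_⟩
  rcases eq_bot_or_eq_top (submoduleOfSMulMem U hU) with h | h
  · exact .inl (Submodule.ext (SetLike.ext_iff.1 h :))
  · exact .inr (Submodule.ext (SetLike.ext_iff.1 h :))

theorem asAlgebraHom_equiv_apply {σ : Representation k G W} (e : ρ.Equiv σ) (x : k[G]) (v : V) :
    σ.asAlgebraHom x (e v) = e (ρ.asAlgebraHom x v) := by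
  induction x using MonoidAlgebra.induction_on with
  | of g => simpa using (IntertwiningMap.isIntertwining _ _ e.toIntertwiningMap g v).symm
  | add x y hx hy => simp [hx, hy]
  | smul c x hx => simp [hx]

theorem smul_eq_zero_of_isSimpleModule [Finite G] {x : k[G]}
    (hx : ∀ (n : ℕ) (ρ : Representation k G (Fin n → k)), ρ.IsIrreducible → ρ.asAlgebraHom x = 0)
    (M : Type*) [AddCommGroup M] [Module k M] [Module k[G] M] [IsScalarTower k k[G] M]
    [IsSimpleModule k[G] M] (m : M) : x • m = 0 := by
  have : FiniteDimensional k M := Module.Finite.trans k[G] M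
  obtain ⟨σ, ⟨e⟩⟩ := exists_equiv_fin (ofModule' M : Representation k G M)
  have h := asAlgebraHom_equiv_apply e x m
  rw [hx _ σ (isIrreducible_congr e (isIrreducible_ofModule' M)), LinearMap.zero_apply] at h
  have hact : (ofModule' M : Representation k G M).asAlgebraHom x = Algebra.lsmul k k M x := by
    rw [asAlgebraHom_def, ofModule', Equiv.apply_symm_apply]
  simpa [hact] using h.symm

theorem exists_isIrreducible_asAlgebraHom_ne_zero [Finite G] [NeZero (Nat.card G : k)] {x : k[G]}
    (hx : x ≠ 0) : ∃ (n : ℕ) (ρ : Representation k G (Fin n → k)), ρ.IsIrreducible ∧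
      ρ.asAlgebraHom x ≠ 0 := by
  by_contra! hkill
  have hall : ∀ y : k[G], x * y = 0 := fun y => by
    have hy : y ∈ sSup {S : Submodule k[G] k[G] | IsSimpleModule k[G] S} :=
      IsSemisimpleModule.sSup_simples_eq_top k[G] k[G] ▸ Submodule.mem_top
    rw [sSup_eq_iSup'] at hy
    induction hy using Submodule.iSup_induction' with
    | mem S y hy =>
      have : IsSimpleModule k[G] S.1 := S.2
      exact congrArg Subtype.val (smul_eq_zero_of_isSimpleModule hkill S.1 ⟨y, hy⟩)
    | zero => exact mul_zero x
    | add y z _ _ hy hz => rw [mul_add, hy, hz, add_zero]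
  exact hx (by simpa using hall 1)

end IrreducibleRepresentations

section CharacterSums

open Representation Module MonoidAlgebra

variable {G H V W : Type*} [Group G] [Group H] [AddCommGroup V] [Module ℂ V]
  [FiniteDimensional ℂ V] [AddCommGroup W] [Module ℂ W] [FiniteDimensional ℂ W]
  {ρ : Representation ℂ G V} {σ : Representation ℂ G W}

theorem eq_one_of_mem_commutator {A : Type*} [CommGroup A] (μ : G →* A) {g : G}
    (hg : g ∈ commutator G) : μ g = 1 :=
  Abelianization.commutator_subset_ker μ hg

theorem exists_apply_ne_one_of_notMem_commutator [Finite G] {g : G} (hg : g ∉ commutator G) :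
    ∃ μ : Abelianization G →* ℂˣ, μ (.of g) ≠ 1 :=
  CommGroup.exists_apply_ne_one_of_hasEnoughRootsOfUnity _ ℂ
    fun h => hg ((QuotientGroup.eq_one_iff g).1 h)

theorem exists_isIrreducible_apply_ne_one [Finite G] {g : G} (hg : g ≠ 1) :
    ∃ (n : ℕ) (ρ : Representation ℂ G (Fin n → ℂ)), ρ.IsIrreducible ∧ ρ g ≠ 1 := by
  obtain ⟨n, ρ, hρ, h⟩ := exists_isIrreducible_asAlgebraHom_ne_zero (k := ℂ)
    (sub_ne_zero.2 fun h => hg (of_injective (h.trans (map_one (of ℂ G)).symm)))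
  exact ⟨n, ρ, hρ, fun h1 => h (by simp [h1, sub_self])⟩

theorem exists_isIrreducible_finrank_ne_one_of_not_commutator_le [Finite G] (S : Subgroup G)
    [S.Normal] (hS : ¬ commutator G ≤ S) :
    ∃ (n : ℕ) (ρ : Representation ℂ G (Fin n → ℂ)), ρ.IsIrreducible ∧
      finrank ℂ (Fin n → ℂ) ≠ 1 ∧ ∀ s ∈ S, ρ s = 1 := by
  obtain ⟨g, hg, hgS⟩ := SetLike.not_le_iff_exists.1 hS
  obtain ⟨n, ρ, hρ, h⟩ := exists_isIrreducible_apply_ne_one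
    (g := QuotientGroup.mk' S g) (by simpa using hgS)
  refine ⟨n, ρ.comp (QuotientGroup.mk' S), isIrreducible_comp hρ (QuotientGroup.mk'_surjective S),
    fun hn => h ?_, fun s hs => ?_⟩
  · obtain ⟨μ, hμ⟩ := exists_apply_eq_smul_of_finrank_eq_one ρ hn
    have hμg := eq_one_of_mem_commutator (μ.comp (QuotientGroup.mk' S)) hg
    exact LinearMap.ext fun v => by rw [hμ, ← MonoidHom.comp_apply, hμg]; simp
  · have hmk : QuotientGroup.mk' S s = 1 := by simpa using hs
    rw [MonoidHom.comp_apply, hmk, map_one]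

theorem IsGCStar.of_surjective (hG : IsGCStar G) {f : G →* H} (hf : Function.Surjective f) :
    IsGCStar H := by
  have hpull : ∀ χ : H → ℂ, IsIrrChar H χ → IsIrrChar G (χ ∘ f) := by
    rintro _ ⟨n, ρ, hρ, rfl⟩
    exact ⟨n, ρ.comp f, isIrreducible_comp hρ hf, rfl⟩
  intro χ ψ hχ hψ hχ1 hψ1 hdeg
  obtain ⟨n, hn, hdvd, α, hα⟩ := hG _ _ (hpull χ hχ) (hpull ψ hψ) (by simpa using hχ1)
    (by simpa using hψ1) (by simpa using hdeg)
  exact ⟨n, hn, (Subgroup.card_dvd_of_surjective f hf).trans hdvd, α, hf.forall.2 hα⟩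

theorem sum_character_subgroup [Finite G] (ρ : Representation ℂ G V) (S : Subgroup G)
    [Fintype S] :
    ∑ s : S, ρ.character s =
      ((Nat.card S * finrank ℂ (invariants (ρ.comp S.subtype)) : ℕ) : ℂ) := by
  have hcard : (Nat.card S : ℂ) ≠ 0 := mod_cast Nat.card_pos.ne'
  have : Invertible (Nat.card S : ℂ) := invertibleOfNonzero hcard
  rw [Nat.cast_mul, ← card_inv_mul_sum_char_eq_finrank (ρ.comp S.subtype : Representation ℂ S V),
    mul_inv_cancel_left₀ hcard]
  rfl

/-- A Galois automorphism fixes the rational number `∑_{s ∈ S} χ(s)`. -/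
theorem IsGCStar.sum_character_eq [Finite G] (hG : IsGCStar G) (hρ : ρ.IsIrreducible)
    (hσ : σ.IsIrreducible) (hne : finrank ℂ V ≠ 1) (heq : finrank ℂ V = finrank ℂ W)
    (S : Subgroup G) [Fintype S] : ∑ s : S, ρ.character s = ∑ s : S, σ.character s := by
  obtain ⟨n, -, -, α, hα⟩ := hG ρ.character σ.character (isIrrChar_character hρ)
    (isIrrChar_character hσ) (by rw [char_one]; exact_mod_cast hne)
    (by rw [char_one, ← heq]; exact_mod_cast hne) (by rw [char_one, char_one, heq])
  choose z hzρ hzσ using hα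
  set m := Nat.card S * finrank ℂ (invariants (ρ.comp S.subtype))
  have hρm : ∑ s : S, ρ.character s = (m : ℂ) := sum_character_subgroup ρ S
  have hz : ∑ s : S, z s = (m : cyclotomicSubfield n) := Subtype.ext (by simpa [hzρ] using hρm)
  have hαz : ∑ s : S, α (z s) = (m : cyclotomicSubfield n) := by rw [← map_sum, hz, map_natCast]
  have hσm : ∑ s : S, σ.character s = (m : ℂ) := by
    simpa [hzσ] using congrArg (Subtype.val : cyclotomicSubfield n → ℂ) hαz
  rw [hρm, hσm]

theorem IsGCStar.finrank_invariants_eq [Finite G] (hG : IsGCStar G) (hρ : ρ.IsIrreducible)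
    (hσ : σ.IsIrreducible) (hne : finrank ℂ V ≠ 1) (heq : finrank ℂ V = finrank ℂ W)
    (S : Subgroup G) : finrank ℂ (invariants (ρ.comp S.subtype)) =
      finrank ℂ (invariants (σ.comp S.subtype)) := by
  have : Fintype S := Fintype.ofFinite S
  have hsum := hG.sum_character_eq hρ hσ hne heq S
  rw [sum_character_subgroup, sum_character_subgroup, Nat.cast_inj] at hsum
  exact Nat.eq_of_mul_eq_mul_left Nat.card_pos hsum

theorem IsGCStar.apply_eq_one_of_apply_eq_one [Finite G] (hG : IsGCStar G) (hρ : ρ.IsIrreducible)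
    (hσ : σ.IsIrreducible) (hne : finrank ℂ V ≠ 1) (heq : finrank ℂ V = finrank ℂ W)
    {S : Subgroup G} (hS : ∀ s ∈ S, ρ s = 1) : ∀ s ∈ S, σ s = 1 := by
  rw [← invariants_comp_subtype_eq_top_iff] at hS ⊢
  apply Submodule.eq_top_of_finrank_eq
  rw [← hG.finrank_invariants_eq hρ hσ hne heq S, hS, finrank_top, heq]

theorem IsGCStar.le_commutator_of_not_commutator_le [Finite G] (hG : IsGCStar G) (S : Subgroup G)
    [S.Normal] (hS : ¬ commutator G ≤ S) : S ≤ commutator G := by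
  obtain ⟨n, ρ, hρ, hn, hker⟩ := exists_isIrreducible_finrank_ne_one_of_not_commutator_le S hS
  intro s hs
  by_contra hsG
  obtain ⟨μ, hμ⟩ := exists_apply_ne_one_of_notMem_commutator hsG
  have htwist := hG.apply_eq_one_of_apply_eq_one hρ
    (isIrreducible_twist hρ (μ.comp Abelianization.of)) hn rfl hker s hs
  rw [twist_apply, hker s hs] at htwist
  have := nontrivial_of_isIrreducible hρ
  have hμs : (μ (Abelianization.of s) : ℂ) = 1 := smul_left_injective ℂ
    (one_ne_zero (α := Module.End ℂ (Fin n → ℂ))) (htwist.trans (one_smul ℂ 1).symm)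
  exact hμ (Units.ext hμs)

theorem sum_linearCharacter_apply [Fintype (Abelianization G →* ℂˣ)] [Finite G] (g : G)
    [Decidable (g ∈ commutator G)] :
    ∑ μ : Abelianization G →* ℂˣ, (μ (.of g) : ℂ) =
      if g ∈ commutator G then (Fintype.card (Abelianization G →* ℂˣ) : ℂ) else 0 := by
  split_ifs with hg
  · have hone : Abelianization.of g = 1 := (QuotientGroup.eq_one_iff g).2 hg
    simp [hone]
  · obtain ⟨φ, hφ⟩ := exists_apply_ne_one_of_notMem_commutator hg
    refine sum_hom_units_eq_zero ((Units.coeHom ℂ).comp (MonoidHom.eval (Abelianization.of g)))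
      fun h => hφ (Units.ext ?_)
    exact DFunLike.congr_fun h φ

/-- Twisting `ρ` by a linear character does not change `∑_{l ∈ L} χ(l)`, so averaging over all
linear characters isolates the part of that sum over `L ∩ tG'`. -/
theorem IsGCStar.character_eq_zero [Finite G] (hG : IsGCStar G) {L : Subgroup G} {t : G}
    (ht : t ∉ commutator G) (htL : t ∈ L)
    (hconj : ∀ l ∈ L, t⁻¹ * l ∈ commutator G → IsConj t l) (hρ : ρ.IsIrreducible)
    (hne : finrank ℂ V ≠ 1) : ρ.character t = 0 := by
  classical
  have : Fintype L := Fintype.ofFinite L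
  have : Fintype (Abelianization G →* ℂˣ) := Fintype.ofFinite _
  have htwist (μ : Abelianization G →* ℂˣ) :
      ∑ l : L, (μ (.of (l : G)) : ℂ) * ρ.character l = ∑ l : L, ρ.character l := by
    rw [hG.sum_character_eq hρ (isIrreducible_twist hρ (μ.comp Abelianization.of)) hne rfl L]
    simp [character_twist]
  have hcoset (l : L) : (∑ μ : Abelianization G →* ℂˣ, (μ (.of (t⁻¹ * l)) : ℂ)) * ρ.character l =
      if t⁻¹ * (l : G) ∈ commutator G then
        Fintype.card (Abelianization G →* ℂˣ) * ρ.character t else 0 := by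
    rw [sum_linearCharacter_apply, ite_mul, zero_mul]
    refine ite_congr rfl (fun hl => ?_) fun _ => rfl
    obtain ⟨g, hg⟩ := isConj_iff.1 (hconj l l.2 hl)
    rw [← hg, char_conj]
  have hsum : ∑ l : L, (if t⁻¹ * (l : G) ∈ commutator G then
      Fintype.card (Abelianization G →* ℂˣ) * ρ.character t else 0) = 0 := by
    calc _ = ∑ l : L, (∑ μ : Abelianization G →* ℂˣ, (μ (.of (t⁻¹ * l)) : ℂ)) * ρ.character l :=
          Finset.sum_congr rfl fun l _ => (hcoset l).symm
      _ = ∑ μ : Abelianization G →* ℂˣ, (μ (.of t⁻¹) : ℂ) *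
          ∑ l : L, (μ (.of (l : G)) : ℂ) * ρ.character l := by
        simp only [Finset.sum_mul, Finset.mul_sum, map_mul, Units.val_mul, mul_assoc]
        exact Finset.sum_comm
      _ = 0 := by
        simp only [htwist]
        rw [← Finset.sum_mul, sum_linearCharacter_apply, if_neg (by rwa [inv_mem_iff]), zero_mul]
  rw [← Finset.sum_filter, Finset.sum_const, nsmul_eq_mul, ← mul_assoc] at hsum
  refine (mul_eq_zero.1 hsum).resolve_left ?_
  have hmem : (⟨t, htL⟩ : L) ∈ ({l | t⁻¹ * (l : G) ∈ commutator G} : Finset L) := by simp [one_mem]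
  exact mul_ne_zero (Nat.cast_ne_zero.2 (Finset.card_ne_zero_of_mem hmem))
    (Nat.cast_ne_zero.2 Fintype.card_ne_zero)

theorem sum_conj_eq_zero_of_character_eq_zero [Fintype G] (hρ : ρ.IsIrreducible) {t : G}
    (ht : ρ.character t = 0) : ∑ y, ρ (y * t * y⁻¹) = 0 := by
  have hcomm : ∀ g, Commute (∑ y, ρ (y * t * y⁻¹)) (ρ g) := fun g => by
    rw [commute_iff_eq, Finset.sum_mul, Finset.mul_sum]
    refine Fintype.sum_equiv (Equiv.mulLeft g⁻¹) _ _ fun y => ?_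
    simp only [← map_mul, Equiv.coe_mulLeft]
    congr 1
    group
  obtain ⟨a, ha⟩ := exists_eq_smul_of_commute hρ hcomm
  have htrace : LinearMap.trace ℂ V (∑ y, ρ (y * t * y⁻¹)) = 0 := by
    rw [map_sum]
    exact Finset.sum_eq_zero fun y _ => (ρ.char_conj t y).trans ht
  have := nontrivial_of_isIrreducible hρ
  have hfin : (finrank ℂ V : ℂ) ≠ 0 := Nat.cast_ne_zero.2 finrank_pos.ne'
  rw [ha, map_smul, LinearMap.trace_one, smul_eq_mul] at htrace
  rw [ha, (mul_eq_zero.1 htrace).resolve_right hfin, zero_smul]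

theorem sum_commutator_eq_zero [Fintype (commutator G)] (hρ : ρ.IsIrreducible)
    (hne : finrank ℂ V ≠ 1) : ∑ c : commutator G, ρ c = 0 :=
  norm_eq_zero_of_invariants_eq_bot (ρ := ρ.comp (commutator G).subtype)
    ((invariants_eq_bot_or_eq_top hρ (commutator G)).resolve_right fun h =>
      hne (finrank_eq_one_of_apply_commutator hρ ((invariants_comp_subtype_eq_top_iff ρ _).1 h)))

theorem card_nsmul_sum_conj_eq [Fintype G] [Fintype (commutator G)] (hρ : ρ.IsIrreducible) {t : G}
    (ht : finrank ℂ V ≠ 1 → ρ.character t = 0) :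
    Fintype.card (commutator G) • ∑ y, ρ (y * t * y⁻¹) =
      Fintype.card G • ∑ c : commutator G, ρ (t * c) := by
  by_cases hne : finrank ℂ V = 1
  · obtain ⟨μ, hμ⟩ := exists_apply_eq_smul_of_finrank_eq_one ρ hne
    have hconj : ∀ y, ρ (y * t * y⁻¹) = ρ t := fun y => LinearMap.ext fun v => by
      simp [hμ]
    have hcoset : ∀ c : commutator G, ρ (t * c) = ρ t := fun c => LinearMap.ext fun v => by
      rw [hμ, hμ, map_mul, eq_one_of_mem_commutator μ c.2, mul_one]
    simp only [hconj, hcoset, Finset.sum_const, Finset.card_univ]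
    exact smul_comm _ _ _
  · simp only [map_mul ρ t, ← Finset.mul_sum]
    rw [sum_conj_eq_zero_of_character_eq_zero hρ (ht hne), sum_commutator_eq_zero hρ hne,
      mul_zero, smul_zero, smul_zero]

theorem isConj_mul_of_forall_character_eq_zero [Finite G] {t : G}
    (ht : ∀ (n : ℕ) (ρ : Representation ℂ G (Fin n → ℂ)), ρ.IsIrreducible →
      finrank ℂ (Fin n → ℂ) ≠ 1 → ρ.character t = 0) {k : G} (hk : k ∈ commutator G) :
    IsConj t (t * k) := by
  classical
  have : Fintype G := Fintype.ofFinite G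
  have : Fintype (commutator G) := Fintype.ofFinite _
  have hx : Fintype.card (commutator G) • ∑ y, of ℂ G (y * t * y⁻¹) =
      Fintype.card G • ∑ c : commutator G, of ℂ G (t * c) := by
    by_contra hx
    obtain ⟨n, ρ, hρ, h⟩ := exists_isIrreducible_asAlgebraHom_ne_zero (sub_ne_zero.2 hx)
    apply h
    simpa [sub_eq_zero] using card_nsmul_sum_conj_eq hρ (ht n ρ hρ)
  by_contra hcon
  have hleft : ∀ y, y * t * y⁻¹ ≠ t * k := fun y h => hcon (isConj_iff.2 ⟨y, h⟩)
  have hright : ∀ c : commutator G, (c : G) = k ↔ c = ⟨k, hk⟩ := fun _ =>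
    (Subtype.ext_iff (a2 := ⟨k, hk⟩)).symm
  have hcoeff : (0 : ℂ) = Fintype.card G := by
    simpa [-nsmul_eq_mul, Finsupp.single_apply, hleft, hright] using
      congrArg (fun x : MonoidAlgebra ℂ G => x.coeff (t * k)) hx
  exact Fintype.card_ne_zero (Nat.cast_eq_zero.1 hcoeff.symm)

theorem IsGCStar.isConj_mul [Finite G] (hG : IsGCStar G) {L : Subgroup G} {t : G}
    (ht : t ∉ commutator G) (htL : t ∈ L)
    (hconj : ∀ l ∈ L, t⁻¹ * l ∈ commutator G → IsConj t l) {k : G} (hk : k ∈ commutator G) :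
    IsConj t (t * k) :=
  isConj_mul_of_forall_character_eq_zero
    (fun _ _ hρ hne => hG.character_eq_zero ht htL hconj hρ hne) hk

end CharacterSums

section LinearCharactersOfNormalSubgroups

open Representation Module MonoidAlgebra

variable {G k V : Type*} [Group G] [Field k] [AddCommGroup V] [Module k V]
  {ρ : Representation k G V} {v : V} {N M : Subgroup G} [N.Normal] {θ : N →* kˣ}

theorem linearIndependent_of_apply_eq_smul {H ι : Type*} [Group H] (σ : Representation k H V)
    {w : ι → V} (hw : ∀ i, w i ≠ 0) {μ : ι → H →* kˣ} (hμ : Function.Injective μ)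
    (h : ∀ i x, σ x (w i) = (μ i x : k) • w i) : LinearIndependent k w := by
  have hinj : Function.Injective fun i => (Units.coeHom k).comp (μ i) := fun i j hij =>
    hμ (MonoidHom.ext fun x => Units.ext (DFunLike.congr_fun hij x))
  have hind := linearIndependent_iff'.1 ((linearIndependent_monoidHom H k).comp _ hinj)
  refine linearIndependent_iff'.2 fun s c hc i hi => ?_
  obtain ⟨f, hf⟩ : ∃ f : Dual k V, f (w i) ≠ 0 := by
    by_contra! hf
    exact hw i ((forall_dual_apply_eq_zero_iff k _).1 hf)
  have hzero := hind s (fun j => c j * f (w j)) (funext fun x => ?_) i hi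
  · exact (mul_eq_zero.1 hzero).resolve_right hf
  calc (∑ j ∈ s, (c j * f (w j)) • ⇑((Units.coeHom k).comp (μ j))) x
      = f (σ x (∑ j ∈ s, c j • w j)) := by simp [h, mul_assoc, mul_comm]
    _ = 0 := by rw [hc, map_zero, map_zero]

/-- The conjugate `θ^g : n ↦ θ(g⁻¹ n g)` of a linear character of a normal subgroup. -/
def conjCharacter (θ : N →* kˣ) (g : G) : N →* kˣ :=
  θ.comp (MulAut.conjNormal g⁻¹ : MulAut N).toMonoidHom

theorem conjCharacter_apply (θ : N →* kˣ) (g : G) (n : N) :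
    conjCharacter θ g n = θ (MulAut.conjNormal g⁻¹ n) := rfl

theorem conjCharacter_one (θ : N →* kˣ) : conjCharacter θ 1 = θ := by
  ext; simp [conjCharacter_apply]

theorem conjCharacter_mul (θ : N →* kˣ) (g h : G) :
    conjCharacter θ (g * h) = conjCharacter (conjCharacter θ h) g := by
  ext; simp [conjCharacter_apply]

theorem conjCharacter_injective (g : G) :
    Function.Injective fun θ : N →* kˣ => conjCharacter θ g :=
  Function.LeftInverse.injective (g := fun θ => conjCharacter θ g⁻¹) fun θ => by
    simp [← conjCharacter_mul, conjCharacter_one]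

/-- The stabilizer in `M` of a linear character of the normal subgroup `N`. -/
def linearCharacterStabilizer (M : Subgroup G) (θ : N →* kˣ) : Subgroup G where
  carrier := {m | m ∈ M ∧ conjCharacter θ m = θ}
  one_mem' := ⟨one_mem _, conjCharacter_one θ⟩
  mul_mem' := fun ⟨ha, ha'⟩ ⟨hb, hb'⟩ =>
    ⟨mul_mem ha hb, by rw [conjCharacter_mul, hb', ha']⟩
  inv_mem' := fun {a} ⟨ha, ha'⟩ => ⟨inv_mem ha, conjCharacter_injective a <| by
    simpa [← conjCharacter_mul, conjCharacter_one] using ha'.symm⟩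

/-- The orbit under `M` of a linear character of the normal subgroup `N`. -/
abbrev linearCharacterOrbit (M : Subgroup G) (θ : N →* kˣ) : Set (N →* kˣ) :=
  Set.range fun m : M => conjCharacter θ m

theorem inv_mul_mem_linearCharacterStabilizer {g m : M}
    (h : conjCharacter θ (g : G) = conjCharacter θ (m : G)) :
    (g : G)⁻¹ * m ∈ linearCharacterStabilizer M θ :=
  ⟨mul_mem (inv_mem g.2) m.2, conjCharacter_injective (g : G) <| by
    simpa [← conjCharacter_mul] using h.symm⟩

theorem apply_apply_of_apply_eq_smul (hN : ∀ n : N, ρ n v = (θ n : k) • v) (g : G) (n : N) :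
    ρ n (ρ g v) = (conjCharacter θ g n : k) • ρ g v := by
  have hmove : (n : G) * g = g * (MulAut.conjNormal g⁻¹ n : N) := by simp [mul_assoc]
  rw [← Module.End.mul_apply, ← map_mul, hmove, map_mul, Module.End.mul_apply, hN, map_smul,
    conjCharacter_apply]

theorem span_range_apply_eq_top (hρ : ρ.IsIrreducible) (hv : v ≠ 0) (hNM : N ⊔ M = ⊤)
    (hN : ∀ n : N, ρ n v = (θ n : k) • v) :
    Submodule.span k (Set.range fun m : M => ρ m v) = ⊤ := by
  have hmem : ∀ m ∈ M, ρ m v ∈ Submodule.span k (Set.range fun m : M => ρ m v) :=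
    fun m hm => Submodule.subset_span ⟨⟨m, hm⟩, rfl⟩
  refine (eq_bot_or_eq_top_of_stable hρ fun g => ?_).resolve_left fun h => hv ?_
  · refine (Submodule.span_le (p := (Submodule.span k _).comap (ρ g))).2 ?_
    rintro _ ⟨m, rfl⟩
    obtain ⟨n, hn, l, hl, rfl⟩ := Subgroup.mem_sup_of_normal_left.1 (hNM ▸ Subgroup.mem_top g)
    rw [SetLike.mem_coe, Submodule.mem_comap, map_mul, Module.End.mul_apply,
      ← Module.End.mul_apply (ρ l), ← map_mul, apply_apply_of_apply_eq_smul hN _ ⟨n, hn⟩]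
    exact Submodule.smul_mem _ _ (hmem _ (mul_mem hl m.2))
  · simpa [h] using hmem 1 M.one_mem

theorem exists_basis_linearCharacterOrbit {ψ : linearCharacterStabilizer M θ →* kˣ}
    (hρ : ρ.IsIrreducible) (hv : v ≠ 0) (hNM : N ⊔ M = ⊤) (hN : ∀ n : N, ρ n v = (θ n : k) • v)
    (hT : ∀ t : linearCharacterStabilizer M θ, ρ t v = (ψ t : k) • v) :
    ∃ b : Basis (linearCharacterOrbit M θ) k V, ∀ m : M, ∃ i t, ρ m v = (ψ t : k) • b i := by
  choose r hr using fun i : linearCharacterOrbit M θ => i.2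
  have hmono : ∀ m : M, ∃ i t, ρ m v = (ψ t : k) • ρ (r i) v := fun m =>
    ⟨Set.rangeFactorization _ m, ⟨_, inv_mul_mem_linearCharacterStabilizer (hr _)⟩, by
      rw [← map_smul, ← hT, ← Module.End.mul_apply, ← map_mul, mul_inv_cancel_left]⟩
  have hind : LinearIndependent k fun i => ρ (r i) v := by
    refine linearIndependent_of_apply_eq_smul (ρ.comp N.subtype) (fun i h => hv ?_)
      Subtype.val_injective fun i n => ?_
    · simpa using congrArg (ρ (r i : G)⁻¹) h
    · exact hr i ▸ apply_apply_of_apply_eq_smul hN (r i : G) n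
  have hspan : ⊤ ≤ Submodule.span k (Set.range fun i => ρ (r i) v) := by
    rw [← span_range_apply_eq_top hρ hv hNM hN, Submodule.span_le]
    rintro _ ⟨m, rfl⟩
    obtain ⟨i, t, h⟩ := hmono m
    exact (congrArg (· ∈ _) h).mpr (Submodule.smul_mem _ _ (Submodule.subset_span ⟨i, rfl⟩))
  exact ⟨Basis.mk hind hspan, by simpa using hmono⟩

theorem invariants_eq_bot_of_ne_one [Finite M] [NeZero (Nat.card M : k)]
    {ψ : linearCharacterStabilizer M θ →* kˣ} (hρ : ρ.IsIrreducible) (hv : v ≠ 0)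
    (hNM : N ⊔ M = ⊤) (hN : ∀ n : N, ρ n v = (θ n : k) • v)
    (hT : ∀ t : linearCharacterStabilizer M θ, ρ t v = (ψ t : k) • v) (hψ : ψ ≠ 1) :
    invariants (ρ.comp M.subtype) = ⊥ := by
  have : Fintype M := Fintype.ofFinite M
  obtain ⟨t, ht⟩ := DFunLike.ne_iff.1 hψ
  let σ : Representation k M V := ρ.comp M.subtype
  have hnorm_v : σ.norm v = 0 := by
    have h : (ψ t : k) • σ.norm v = σ.norm v := by
      rw [← map_smul, ← hT]
      exact σ.norm_self_apply ⟨t, t.2.1⟩ v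
    rw [← sub_eq_zero, ← one_smul k (σ.norm v), smul_smul, mul_one, ← sub_smul] at h
    exact (smul_eq_zero.1 h).resolve_left fun h => ht (Units.ext (sub_eq_zero.1 h))
  have hnorm : σ.norm = 0 := LinearMap.ext_on_range (span_range_apply_eq_top hρ hv hNM hN)
    fun m => (σ.norm_self_apply m v).trans hnorm_v
  refine eq_bot_iff.2 fun w hw => ?_
  have hfix : ∀ m : M, ρ m w = w := hw
  have hcard : (Nat.card M : k) • w = 0 := by
    simpa [σ, Representation.norm, hfix, Nat.cast_smul_eq_nsmul] using LinearMap.congr_fun hnorm w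
  exact (smul_eq_zero.1 hcard).resolve_left (NeZero.ne _)

theorem invariants_ne_bot_of_apply_eq_self [Finite M] [NeZero (Nat.card M : k)]
    (hρ : ρ.IsIrreducible) (hv : v ≠ 0) (hNM : N ⊔ M = ⊤) (hN : ∀ n : N, ρ n v = (θ n : k) • v)
    (hT : ∀ t : linearCharacterStabilizer M θ, ρ t v = v) :
    invariants (ρ.comp M.subtype) ≠ ⊥ := by
  have : Fintype M := Fintype.ofFinite M
  obtain ⟨b, hb⟩ := exists_basis_linearCharacterOrbit (ψ := 1) hρ hv hNM hN (by simpa using hT)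
  let f : V →ₗ[k] k := b.constr k fun _ => 1
  have hf : ∀ m : M, f (ρ m v) = 1 := fun m => by
    obtain ⟨i, t, h⟩ := hb m
    simp [h, f]
  have hsum : f (Representation.norm (ρ.comp M.subtype) v) = Nat.card M := by
    simp [Representation.norm, hf]
  intro hbot
  rw [norm_eq_zero_of_invariants_eq_bot hbot, LinearMap.zero_apply, map_zero] at hsum
  exact NeZero.ne _ hsum.symm

theorem exists_isIrreducible_apply_eq_smul {H : Type*} [Group H] [Finite G]
    [NeZero (Nat.card G : k)] {j : H →* G} (hj : Function.Injective j) (μ : H →* kˣ) :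
    ∃ (n : ℕ) (ρ : Representation k G (Fin n → k)), ρ.IsIrreducible ∧
      ∃ v ≠ 0, ∀ h, ρ (j h) v = (μ h : k) • v := by
  classical
  have : Finite H := Finite.of_injective j hj
  have : Fintype H := Fintype.ofFinite H
  let x : MonoidAlgebra k G := ∑ h, (μ h⁻¹ : k) • of k G (j h)
  have hx : x ≠ 0 := fun hx => by
    have hcoeff := congrArg (fun y : MonoidAlgebra k G => y.coeff 1) hx
    simp [x, Finsupp.single_apply, map_eq_one_iff j hj] at hcoeff
  obtain ⟨n, ρ, hρ, hρx⟩ := exists_isIrreducible_asAlgebraHom_ne_zero hx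
  obtain ⟨w, hw⟩ := DFunLike.ne_iff.1 hρx
  refine ⟨n, ρ, hρ, _, hw, fun h => ?_⟩
  have hmul : of k G (j h) * x = (μ h : k) • x := by
    simp only [x, Finset.mul_sum, Finset.smul_sum]
    refine Fintype.sum_equiv (Equiv.mulLeft h) _ _ fun g => ?_
    simp [mul_comm (μ g : k)⁻¹]
  rw [← asAlgebraHom_of, ← Module.End.mul_apply, ← map_mul, hmul, map_smul, LinearMap.smul_apply]

theorem exists_isIrreducible_of_linearCharacter [Finite G] [NeZero (Nat.card G : k)]
    (hNM : Disjoint N M) (θ : N →* kˣ) (ψ : linearCharacterStabilizer M θ →* kˣ) :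
    ∃ (n : ℕ) (ρ : Representation k G (Fin n → k)), ρ.IsIrreducible ∧ ∃ v ≠ 0,
      (∀ n : N, ρ n v = (θ n : k) • v) ∧
        ∀ t : linearCharacterStabilizer M θ, ρ t v = (ψ t : k) • v := by
  let T := linearCharacterStabilizer M θ
  let φ : T →* MulAut N := MulAut.conjNormal.comp T.subtype
  let j : N ⋊[φ] T →* G := SemidirectProduct.lift N.subtype T.subtype fun t => by
    ext n; simp [φ]
  have hj : Function.Injective j := (injective_iff_map_eq_one j).2 fun x hx => by
    have hprod : (x.left : G) * x.right = 1 := hx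
    obtain ⟨hl, hr⟩ := (Subgroup.disjoint_iff_mul_eq_one.1 hNM) x.left.2 x.right.2.1 hprod
    exact SemidirectProduct.ext (Subtype.ext hl) (Subtype.ext hr)
  let μ : N ⋊[φ] T →* kˣ := SemidirectProduct.lift θ ψ fun t => MonoidHom.ext fun n => by
    have h := DFunLike.congr_fun t.2.2 (φ t n)
    simpa [φ, conjCharacter_apply] using h.symm
  obtain ⟨n, ρ, hρ, v, hv, h⟩ := exists_isIrreducible_apply_eq_smul hj μ
  exact ⟨n, ρ, hρ, v, hv, fun a => by simpa [j, μ] using h (.inl a),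
    fun t => by simpa [j, μ] using h (.inr t)⟩

/- Extend `θ` by the linear characters `1` and `ψ ≠ 1` of its stabilizer. The irreducible
representations they induce have the same degree, but only the first has `M`-invariants. Hence the
stabilizer has no linear character `ψ ≠ 1`, and being solvable it is trivial. -/
theorem IsGCStar.linearCharacterStabilizer_eq_bot [Finite G] [Group.IsSolvable G] (hG : IsGCStar G)
    (hNM : N.IsComplement' M) {θ : N →* ℂˣ} (hθ : ∃ m ∈ M, conjCharacter θ m ≠ θ) :
    linearCharacterStabilizer M θ = ⊥ := by
  let T := linearCharacterStabilizer M θ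
  have hψ : ∀ ψ : T →* ℂˣ, ψ = 1 := by
    by_contra! hψ
    obtain ⟨ψ, hψ⟩ := hψ
    obtain ⟨n₁, ρ, hρ, v, hv, hvN, hvT⟩ :=
      exists_isIrreducible_of_linearCharacter hNM.disjoint θ (1 : T →* ℂˣ)
    obtain ⟨n₂, σ, hσ, w, hw, hwN, hwT⟩ := exists_isIrreducible_of_linearCharacter hNM.disjoint θ ψ
    obtain ⟨b, -⟩ := exists_basis_linearCharacterOrbit hρ hv hNM.sup_eq_top hvN hvT
    obtain ⟨c, -⟩ := exists_basis_linearCharacterOrbit hσ hw hNM.sup_eq_top hwN hwT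
    have hdeg := finrank_eq_nat_card_basis b
    have hne : finrank ℂ (Fin n₁ → ℂ) ≠ 1 := fun h => by
      obtain ⟨m, hm, hmθ⟩ := hθ
      have := (Nat.card_eq_one_iff_unique.1 (hdeg.symm.trans h)).1
      have horbit : (⟨_, ⟨m, hm⟩, rfl⟩ : linearCharacterOrbit M θ) = ⟨_, 1, rfl⟩ :=
        Subsingleton.elim _ _
      exact hmθ ((Subtype.ext_iff.1 horbit).trans (conjCharacter_one θ))
    have hinv := hG.finrank_invariants_eq hρ hσ hne
      (hdeg.trans (finrank_eq_nat_card_basis c).symm) M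
    rw [invariants_eq_bot_of_ne_one hσ hw hNM.sup_eq_top hwN hwT hψ, finrank_bot,
      Submodule.finrank_eq_zero] at hinv
    exact invariants_ne_bot_of_apply_eq_self hρ hv hNM.sup_eq_top hvN (by simpa using hvT) hinv
  by_contra hT
  have : Nontrivial T := (Subgroup.nontrivial_iff_ne_bot T).2 hT
  obtain ⟨t, -, ht⟩ := SetLike.exists_of_lt (Group.IsSolvable.commutator_lt_top_of_nontrivial T)
  obtain ⟨ψ, hψt⟩ := exists_apply_ne_one_of_notMem_commutator ht
  exact hψt (DFunLike.congr_fun (hψ (ψ.comp Abelianization.of)) t)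

end LinearCharactersOfNormalSubgroups

section NilpotentResidual

variable {G : Type*} [Group G]

theorem nilpotentResidual_le_lowerCentralSeries (n : ℕ) :
    nilpotentResidual G ≤ (⊤ : Subgroup G).lowerCentralSeries n := iInf_le _ n

instance nilpotentResidual_normal : (nilpotentResidual G).Normal :=
  Subgroup.normal_iInf_normal fun _ => inferInstance

theorem nilpotentResidual_le_commutator : nilpotentResidual G ≤ commutator G :=
  (nilpotentResidual_le_lowerCentralSeries 1).trans_eq Subgroup.top_lowerCentralSeries_one

theorem nilpotentResidual_ne_top [Group.IsSolvable G] [Nontrivial G] :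
    nilpotentResidual G ≠ ⊤ := fun h =>
  (Group.IsSolvable.commutator_lt_top_of_nontrivial G).not_ge
    (h.symm.trans_le nilpotentResidual_le_commutator)

variable [Finite G]

theorem exists_lowerCentralSeries_eq_nilpotentResidual :
    ∃ n, ∀ m ≥ n, (⊤ : Subgroup G).lowerCentralSeries m = nilpotentResidual G := by
  have hanti := Subgroup.lowerCentralSeries_antitone (⊤ : Subgroup G)
  obtain ⟨n, hstable⟩ := WellFoundedLT.antitone_chain_condition hanti
  refine ⟨n, fun m hm => le_antisymm (le_iInf fun i => ?_)
    (nilpotentResidual_le_lowerCentralSeries m)⟩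
  rw [← hstable m hm]
  rcases le_total n i with hi | hi
  · exact (hstable i hi).le
  · exact hanti hi

theorem commutator_nilpotentResidual_top :
    ⁅nilpotentResidual G, (⊤ : Subgroup G)⁆ = nilpotentResidual G := by
  obtain ⟨n, hn⟩ := exists_lowerCentralSeries_eq_nilpotentResidual (G := G)
  rw [← hn n le_rfl, ← Subgroup.lowerCentralSeries_succ, hn n le_rfl, hn (n + 1) n.le_succ]

theorem isNilpotent_iff_nilpotentResidual_eq_bot :
    Group.IsNilpotent G ↔ nilpotentResidual G = ⊥ := by
  rw [Subgroup.nilpotent_iff_lowerCentralSeries]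
  obtain ⟨n, hn⟩ := exists_lowerCentralSeries_eq_nilpotentResidual (G := G)
  exact ⟨fun ⟨m, hm⟩ => eq_bot_iff.2 (hm ▸ nilpotentResidual_le_lowerCentralSeries m),
    fun h => ⟨n, (hn n le_rfl).trans h⟩⟩

theorem nilpotentResidual_quotient (N : Subgroup G) [N.Normal] :
    nilpotentResidual (G ⧸ N) = (nilpotentResidual G).map (QuotientGroup.mk' N) := by
  obtain ⟨n, hn⟩ := exists_lowerCentralSeries_eq_nilpotentResidual (G := G)
  obtain ⟨m, hm⟩ := exists_lowerCentralSeries_eq_nilpotentResidual (G := G ⧸ N)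
  rw [← hn (max n m) (le_max_left _ _), ← hm (max n m) (le_max_right _ _),
    Subgroup.map_lowerCentralSeries,
    Subgroup.map_top_of_surjective _ (QuotientGroup.mk'_surjective N)]

theorem isNilpotent_quotient_iff (N : Subgroup G) [N.Normal] :
    Group.IsNilpotent (G ⧸ N) ↔ nilpotentResidual G ≤ N := by
  rw [isNilpotent_iff_nilpotentResidual_eq_bot, nilpotentResidual_quotient,
    Subgroup.map_eq_bot_iff, QuotientGroup.ker_mk']

end NilpotentResidual

section MinimalNormalSubgroups

open scoped IsMulCommutative

variable {G : Type*} [Group G]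

/-- Minimal normal subgroups: the minimal elements among the nontrivial normal subgroups. -/
def IsMinimalNormal (N : Subgroup G) : Prop :=
  Minimal (fun K : Subgroup G => K.Normal ∧ K ≠ ⊥) N

variable {N M : Subgroup G}

theorem exists_isMinimalNormal_le [Finite G] {R : Subgroup G} [R.Normal] (hR : R ≠ ⊥) :
    ∃ N ≤ R, IsMinimalNormal N :=
  (Set.toFinite {K : Subgroup G | K.Normal ∧ K ≠ ⊥}).exists_le_minimal ⟨‹_›, hR⟩

theorem IsMinimalNormal.eq_of_le (hN : IsMinimalNormal N) {K : Subgroup G} [K.Normal]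
    (hK : K ≠ ⊥) (hKN : K ≤ N) : K = N :=
  (Minimal.eq_of_ge hN ⟨‹_›, hK⟩ hKN).symm

theorem IsMinimalNormal.eq_top_of_characteristic (hN : IsMinimalNormal N) {K : Subgroup N}
    [K.Characteristic] (hK : K ≠ ⊥) : K = ⊤ := by
  have := hN.prop.1
  have hmap : K.map N.subtype = N :=
    hN.eq_of_le ((Subgroup.map_eq_bot_iff_of_injective _ N.subtype_injective).not.2 hK)
      (Subgroup.map_subtype_le K)
  rw [eq_top_iff, ← Subgroup.map_subtype_le_map_subtype, hmap]
  exact Subgroup.map_subtype_le ⊤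

theorem IsMinimalNormal.isMulCommutative [Group.IsSolvable G] (hN : IsMinimalNormal N) :
    IsMulCommutative N := by
  have := (Subgroup.nontrivial_iff_ne_bot N).2 hN.prop.2
  refine (commutator_eq_bot_iff N).1 (by_contra fun h => ?_)
  exact (Group.IsSolvable.commutator_lt_top_of_nontrivial N).ne (hN.eq_top_of_characteristic h)

theorem IsMinimalNormal.exists_isPGroup [Finite G] [Group.IsSolvable G] (hN : IsMinimalNormal N) :
    ∃ p : ℕ, p.Prime ∧ IsPGroup p N := by
  have := hN.isMulCommutative
  obtain ⟨p, hp, hpN⟩ := Nat.exists_prime_and_dvd fun h => hN.prop.2 (N.eq_bot_of_card_eq h)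
  have := Fact.mk hp
  have : (powMonoidHom p : N →* N).ker.Characteristic :=
    Subgroup.characteristic_iff_le_comap.2 fun e x hx => by
      have hxp : x ^ p = 1 := hx
      simp [← map_pow, hxp]
  obtain ⟨x, hx⟩ := exists_prime_orderOf_dvd_card' (G := N) p hpN
  have htop : (powMonoidHom p : N →* N).ker = ⊤ := by
    refine hN.eq_top_of_characteristic fun h => ?_
    have hx' : x ∈ (powMonoidHom p : N →* N).ker := hx ▸ pow_orderOf_eq_one x
    rw [h, Subgroup.mem_bot] at hx'
    exact hp.one_lt.ne (by rw [← hx, hx', orderOf_one])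
  exact ⟨p, hp, fun x => ⟨1, by simpa using htop.ge (Subgroup.mem_top x)⟩⟩

theorem isComplement'_or_eq_top_of_isMinimalNormal [IsMulCommutative N] (hN : IsMinimalNormal N)
    (hMN : M ⊔ N = ⊤) : N.IsComplement' M ∨ M = ⊤ := by
  have := hN.prop.1
  have hnormal : (N ⊓ M).Normal := by
    rw [← Subgroup.normalizer_eq_top_iff, eq_top_iff, ← hMN]
    refine sup_le ?_ ?_
    · refine le_trans (le_inf ?_ Subgroup.le_normalizer) Subgroup.inf_normalizer_le_normalizer_inf
      exact le_top.trans_eq (Subgroup.normalizer_eq_top N).symm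
    · exact (N.le_centralizer.trans (Subgroup.centralizer_le inf_le_left)).trans
        (Subgroup.centralizer_le_normalizer _)
  by_cases h : N ⊓ M = ⊥
  · left
    refine Subgroup.isComplement'_of_disjoint_and_mul_eq_univ (disjoint_iff.2 h) ?_
    rw [← Subgroup.normal_mul, sup_comm, hMN, Subgroup.coe_top]
  · right
    rw [← hMN, left_eq_sup, ← hN.eq_of_le h inf_le_left]
    exact inf_le_right

end MinimalNormalSubgroups

section FixedLinearCharacters

variable {G k : Type*} [Group G] [Field k] {N M : Subgroup G} [N.Normal] {θ : N →* kˣ}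

theorem conjCharacter_coe (θ : N →* kˣ) (n : N) : conjCharacter θ n = θ := by
  ext a
  rw [conjCharacter_apply, show MulAut.conjNormal (n : G)⁻¹ a = n⁻¹ * a * n by ext; simp]
  simp [mul_comm]

theorem conjCharacter_eq_of_sup_eq_top (hNM : N ⊔ M = ⊤) (h : ∀ m ∈ M, conjCharacter θ m = θ)
    (g : G) : conjCharacter θ g = θ := by
  obtain ⟨n, hn, m, hm, rfl⟩ := Subgroup.mem_sup_of_normal_left.1 (hNM ▸ Subgroup.mem_top g)
  rw [conjCharacter_mul, h m hm, conjCharacter_coe θ ⟨n, hn⟩]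

open scoped commutatorElement in
theorem eq_one_of_forall_conjCharacter_eq (hN : ⁅N, (⊤ : Subgroup G)⁆ = N)
    (h : ∀ g : G, conjCharacter θ g = θ) : θ = 1 := by
  have hker : ⁅N, (⊤ : Subgroup G)⁆ ≤ θ.ker.map N.subtype := by
    refine Subgroup.commutator_le.2 fun n hn g _ => ?_
    refine ⟨⟨n, hn⟩ * MulAut.conjNormal g ⟨n, hn⟩⁻¹, ?_, by simp [commutatorElement_def, mul_assoc]⟩
    have hfix := DFunLike.congr_fun (h g⁻¹) ⟨n, hn⟩⁻¹
    rw [conjCharacter_apply, inv_inv] at hfix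
    rw [SetLike.mem_coe, MonoidHom.mem_ker, map_mul, hfix, ← map_mul, mul_inv_cancel, map_one]
  ext n
  obtain ⟨a, ha, han⟩ := hker (hN.ge n.2)
  rw [← Subtype.ext han, ha, MonoidHom.one_apply]

/-- The conjugation action of `G` on the group of linear characters of a normal subgroup. -/
abbrev conjCharacterAction : MulDistribMulAction G (N →* kˣ) where
  smul g θ := conjCharacter θ g
  one_smul := conjCharacter_one
  mul_smul g h θ := conjCharacter_mul θ g h
  smul_mul _ _ _ := rfl
  smul_one _ := rfl

theorem nonempty_linearCharacter_equiv_abelianization (A : Type*) [Group A] [Finite A] :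
    Nonempty ((A →* ℂˣ) ≃ Abelianization A) :=
  (CommGroup.monoidHom_mulEquiv_of_hasEnoughRootsOfUnity (Abelianization A) ℂ).map fun e =>
    Abelianization.lift.trans e.toEquiv

theorem nontrivial_linearCharacter (A : Type*) [Group A] [Finite A] [Nontrivial A]
    [Group.IsSolvable A] : Nontrivial (A →* ℂˣ) := by
  obtain ⟨e⟩ := nonempty_linearCharacter_equiv_abelianization A
  have : Nontrivial (Abelianization A) :=
    QuotientGroup.nontrivial_iff.2 (Group.IsSolvable.commutator_lt_top_of_nontrivial A).ne
  exact e.nontrivial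

theorem exists_ne_one_forall_conjCharacter_eq [Finite N] {p : ℕ} [Fact p.Prime] (hN : N ≠ ⊥)
    (hNp : IsPGroup p N) (hMp : IsPGroup p M) :
    ∃ θ : N →* ℂˣ, θ ≠ 1 ∧ ∀ m ∈ M, conjCharacter θ m = θ := by
  let _ : MulDistribMulAction G (N →* ℂˣ) := conjCharacterAction
  obtain ⟨e⟩ := nonempty_linearCharacter_equiv_abelianization N
  have : Finite (N →* ℂˣ) := .of_equiv _ e.symm
  have : Nontrivial N := (Subgroup.nontrivial_iff_ne_bot N).2 hN
  have : Group.IsNilpotent N := hNp.isNilpotent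
  have hp : p ∣ Nat.card (N →* ℂˣ) := by
    rw [Nat.card_congr e]
    refine (hNp.to_quotient _).card_eq_or_dvd.resolve_left fun h => ?_
    exact (Group.IsSolvable.commutator_lt_top_of_nontrivial N).ne (Subgroup.index_eq_one.1 h)
  obtain ⟨θ, hθ, hne⟩ := hMp.exists_fixed_point_of_prime_dvd_card_of_fixed_point (N →* ℂˣ) hp
    (a := 1) fun _ => rfl
  exact ⟨θ, hne.symm, fun m hm => hθ ⟨m, hm⟩⟩

end FixedLinearCharacters

section CoprimeResidual

variable {G : Type*} [Group G] {N M : Subgroup G} [N.Normal] {p q : ℕ} [Fact p.Prime] [Fact q.Prime]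

theorem dvd_card_map_mk'_of_not_dvd {A : Subgroup G} (hN : ¬ p ∣ Nat.card N)
    (hA : p ∣ Nat.card A) : p ∣ Nat.card (A.map (QuotientGroup.mk' N)) := by
  rw [← Subgroup.relIndex_ker, QuotientGroup.ker_mk']
  rw [← (N.subgroupOf A).card_mul_index] at hA
  refine ((Fact.out : p.Prime).dvd_mul.1 hA).resolve_left fun h => hN (h.trans ?_)
  exact Subgroup.card_comap_dvd_of_injective N A.subtype A.subtype_injective

theorem dvd_index_map_mk'_of_not_dvd {A : Subgroup G} [A.Normal] (hN : ¬ p ∣ Nat.card N)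
    (hA : p ∣ A.index) :
    p ∣ (A.map (QuotientGroup.mk' N)).index := by
  rw [Subgroup.index_map, QuotientGroup.ker_mk', QuotientGroup.range_mk', Subgroup.index_top,
    mul_one]
  rw [← Subgroup.relIndex_mul_index (le_sup_left : A ≤ A ⊔ N), Subgroup.relIndex_sup_left] at hA
  exact ((Fact.out : p.Prime).dvd_mul.1 hA).resolve_left fun h =>
    hN (h.trans (A.relIndex_dvd_card N))

variable [Finite G]

theorem IsGCStar.le_centralizer_of_isComplement' (hG : IsGCStar G) [Group.IsSolvable G]
    (hN : IsMinimalNormal N) (hNp : IsPGroup p N) (hNM : N.IsComplement' M) (hp : p ∣ N.index) :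
    N ≤ Subgroup.centralizer (M : Set G) := by
  rw [hNM.symm.index_eq_card] at hp
  obtain ⟨m, hm⟩ := exists_prime_orderOf_dvd_card' (G := M) p hp
  have hmp : IsPGroup p (Subgroup.zpowers (m : G)) :=
    IsPGroup.of_card (n := 1) (by rw [Nat.card_zpowers, Subgroup.orderOf_coe, hm, pow_one])
  obtain ⟨θ, hθ, hfix⟩ := exists_ne_one_forall_conjCharacter_eq hN.prop.2 hNp hmp
  have hM : ∀ g ∈ M, conjCharacter θ g = θ := by
    by_contra! hmoved
    have hmem : (m : G) ∈ linearCharacterStabilizer M θ :=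
      ⟨m.2, hfix m (Subgroup.mem_zpowers (m : G))⟩
    rw [hG.linearCharacterStabilizer_eq_bot hNM hmoved, Subgroup.mem_bot,
      OneMemClass.coe_eq_one] at hmem
    exact (Fact.out : p.Prime).one_lt.ne (by rw [← hm, hmem, orderOf_one])
  have hcomm : ⁅N, (⊤ : Subgroup G)⁆ = ⊥ := by
    by_contra h
    exact hθ (eq_one_of_forall_conjCharacter_eq (hN.eq_of_le h (Subgroup.commutator_le_left _ _))
      (conjCharacter_eq_of_sup_eq_top hNM.sup_eq_top hM))
  exact (Subgroup.commutator_eq_bot_iff_le_centralizer.1 hcomm).trans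
    (Subgroup.centralizer_le (Set.subset_univ _))

theorem sylow_sup_ker_eq_top {K : Type*} [Group K] {f : G →* K} (hf : Function.Surjective f)
    (hK : IsPGroup p K) (P : Sylow p G) : (P : Subgroup G) ⊔ f.ker = ⊤ := by
  have hmap : (P : Subgroup G).map f = f.range := by
    rw [← Sylow.coe_mapSurjective hf P, MonoidHom.range_eq_top.2 hf]
    exact ((P.mapSurjective hf).is_maximal' (hK.to_subgroup ⊤) le_top).symm
  exact (Subgroup.map_eq_range_iff.1 hmap).eq_top

theorem exists_isPGroup_normalizer_sup_eq_top {S : Subgroup (G ⧸ N)} [S.Normal] (hS : S ≠ ⊥)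
    (hSp : IsPGroup p S) :
    ∃ H : Subgroup G, IsPGroup p H ∧ H ≠ ⊥ ∧ Subgroup.normalizer (H : Set G) ⊔ N = ⊤ := by
  let f := (QuotientGroup.mk' N).subgroupComap S
  have hsurj : Function.Surjective f :=
    MonoidHom.subgroupComap_surjective_of_surjective _ S (QuotientGroup.mk'_surjective N)
  let P : Sylow p (S.comap (QuotientGroup.mk' N)) := default
  have hker : f.ker.map (S.comap (QuotientGroup.mk' N)).subtype ≤ N := by
    rintro _ ⟨x, hx, rfl⟩
    exact (QuotientGroup.eq_one_iff _).1 (congrArg Subtype.val hx)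
  have hle : S.comap (QuotientGroup.mk' N) ≤ P.map (Subgroup.subtype _) ⊔ N := by
    have htop := congrArg (Subgroup.map (Subgroup.subtype _)) (sylow_sup_ker_eq_top hsurj hSp P)
    rw [Subgroup.map_sup, ← MonoidHom.range_eq_map, Subgroup.range_subtype] at htop
    exact htop.ge.trans (sup_le_sup_left hker _)
  refine ⟨P.map (Subgroup.subtype _), P.2.map _, fun hbot => hS ?_, ?_⟩
  · rw [hbot, bot_sup_eq] at hle
    rw [← Subgroup.map_comap_eq_self_of_surjective (QuotientGroup.mk'_surjective N) S,
      Subgroup.map_eq_bot_iff, QuotientGroup.ker_mk']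
    exact hle
  · rw [eq_top_iff, ← Sylow.normalizer_sup_eq_top P]
    exact sup_le le_sup_left (hle.trans (sup_le_sup_right Subgroup.le_normalizer N))

theorem IsGCStar.exists_normal_isPGroup_of_quotient (hG : IsGCStar G) [Group.IsSolvable G]
    (hN : IsMinimalNormal N) (hNp : IsPGroup p N) (hp : p ∣ N.index) {S : Subgroup (G ⧸ N)}
    [S.Normal] (hS : S ≠ ⊥) (hSq : IsPGroup q S) :
    ∃ H : Subgroup G, H.Normal ∧ H ≠ ⊥ ∧ IsPGroup q H := by
  have := hN.isMulCommutative
  obtain ⟨H, hHq, hH, hsup⟩ := exists_isPGroup_normalizer_sup_eq_top hS hSq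
  refine ⟨H, Subgroup.normalizer_eq_top_iff.1 ?_, hH, hHq⟩
  refine (isComplement'_or_eq_top_of_isMinimalNormal hN hsup).resolve_left fun hcompl => ?_
  have hle : N ≤ Subgroup.normalizer (H : Set G) :=
    (hG.le_centralizer_of_isComplement' hN hNp hcompl hp).trans <|
      (Subgroup.centralizer_le Subgroup.le_normalizer).trans (Subgroup.centralizer_le_normalizer _)
  exact hN.prop.2 (disjoint_self.1 (hcompl.disjoint.mono_right hle))

theorem exists_prime_ne_dvd_card_of_not_isPGroup (h : ¬ IsPGroup p G) :
    ∃ q : ℕ, q.Prime ∧ q ≠ p ∧ q ∣ Nat.card G := by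
  contrapose! h
  refine (isPGroup_iff_primeFactors_card_subset (Fact.out : p.Prime).ne_zero).2 fun q hq => ?_
  obtain ⟨hq, hdvd, -⟩ := Nat.mem_primeFactors.1 hq
  rw [(Fact.out : p.Prime).primeFactors, Finset.mem_singleton]
  exact by_contra fun hne => h q hq hne hdvd

theorem eq_of_prime_dvd_card_of_isPGroup (h : IsPGroup p G) (hq : q ∣ Nat.card G) : q = p := by
  obtain ⟨n, hn⟩ := IsPGroup.iff_card.1 h
  exact (Nat.prime_eq_prime_of_dvd_pow Fact.out Fact.out (hn ▸ hq))

theorem exists_normal_isPGroup_ne_quotient [Group.IsSolvable G] (hnil : ¬ Group.IsNilpotent G)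
    (hNp : IsPGroup p N)
    (hp : ¬ p ∣ Nat.card ((nilpotentResidual G).map (QuotientGroup.mk' N))) :
    ∃ q : ℕ, q.Prime ∧ q ≠ p ∧ ∃ S : Subgroup (G ⧸ N), S.Normal ∧ S ≠ ⊥ ∧ IsPGroup q S := by
  rw [← nilpotentResidual_quotient] at hp
  by_cases hR : nilpotentResidual (G ⧸ N) = ⊥
  · have hnil' : Group.IsNilpotent (G ⧸ N) := isNilpotent_iff_nilpotentResidual_eq_bot.2 hR
    have hquot : ¬ IsPGroup p (G ⧸ N) := fun h => hnil <| by
      have hker : IsPGroup p (QuotientGroup.mk' N).ker := (QuotientGroup.ker_mk' N).symm ▸ hNp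
      have hcomap := (h.to_subgroup ⊤).comap_of_ker_isPGroup (QuotientGroup.mk' N) hker
      rw [Subgroup.comap_top] at hcomap
      exact (hcomap.of_equiv Subgroup.topEquiv).isNilpotent
    obtain ⟨q, hq, hqp, hdvd⟩ := exists_prime_ne_dvd_card_of_not_isPGroup hquot
    have := Fact.mk hq
    let P : Sylow q (G ⧸ N) := default
    exact ⟨q, hq, hqp, P, inferInstance, P.ne_bot_of_dvd_card hdvd, P.2⟩
  · obtain ⟨S, hSR, hS⟩ := exists_isMinimalNormal_le hR
    obtain ⟨q, hq, hSq⟩ := hS.exists_isPGroup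
    refine ⟨q, hq, ?_, S, hS.prop.1, hS.prop.2, hSq⟩
    rintro rfl
    exact hp <| (hSq.card_eq_or_dvd.resolve_left fun h => hS.prop.2 (S.eq_bot_of_card_eq h)).trans
      (Subgroup.card_dvd_of_le hSR)

/- A prime `r` dividing both order and index of the residual `R` divides the order of every
nontrivial normal subgroup, by induction applied to the quotient. But if `N ≤ R` is minimal normal,
then `G ⧸ N` has a nontrivial normal `q`-subgroup with `q ≠ r`, and hence so does `G`. -/
theorem IsGCStar.coprime_card_index_nilpotentResidual {G : Type*} [Group G] [Finite G]
    [Group.IsSolvable G] (hG : IsGCStar G) :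
    (Nat.card (nilpotentResidual G)).Coprime (nilpotentResidual G).index := by
  induction hn : Nat.card G using Nat.strong_induction_on generalizing G with
  | _ n ih =>
  subst hn
  have hquot (N : Subgroup G) [N.Normal] (hN : N ≠ ⊥) :
      (Nat.card ((nilpotentResidual G).map (QuotientGroup.mk' N))).Coprime
        ((nilpotentResidual G).map (QuotientGroup.mk' N)).index := by
    rw [← nilpotentResidual_quotient]
    refine ih _ ?_ (hG.of_surjective (QuotientGroup.mk'_surjective N)) rfl
    rw [← N.index_eq_card, ← N.index_mul_card]
    exact lt_mul_of_one_lt_right (Nat.pos_of_ne_zero N.index_ne_zero_of_finite)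
      (N.one_lt_card_iff_ne_bot.2 hN)
  by_contra hcop
  obtain ⟨r, hr, hcard, hindex⟩ := Nat.Prime.not_coprime_iff_dvd.1 hcop
  have := Fact.mk hr
  have hdvd (N : Subgroup G) (hn : N.Normal) (hN : N ≠ ⊥) : r ∣ Nat.card N := by
    by_contra h
    exact Nat.Prime.not_coprime_iff_dvd.2 ⟨r, hr, dvd_card_map_mk'_of_not_dvd h hcard,
      dvd_index_map_mk'_of_not_dvd h hindex⟩ (hquot N hN)
  have hR : nilpotentResidual G ≠ ⊥ := fun h => hr.not_dvd_one (by simpa [h] using hcard)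
  obtain ⟨N, hNR, hN⟩ := exists_isMinimalNormal_le hR
  have := hN.prop.1
  obtain ⟨p, hp, hNp⟩ := hN.exists_isPGroup
  have := Fact.mk hp
  obtain rfl := eq_of_prime_dvd_card_of_isPGroup hNp (hdvd N hN.prop.1 hN.prop.2)
  have hcard_map : ¬ r ∣ Nat.card ((nilpotentResidual G).map (QuotientGroup.mk' N)) := fun h =>
    Nat.Prime.not_coprime_iff_dvd.2 ⟨r, hr, h, by
      rwa [Subgroup.index_map_eq _ (QuotientGroup.mk'_surjective N) (by simpa using hNR)]⟩
      (hquot N hN.prop.2)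
  obtain ⟨q, hq, hqr, S, hSn, hS, hSq⟩ := exists_normal_isPGroup_ne_quotient
    (mt isNilpotent_iff_nilpotentResidual_eq_bot.1 hR) hNp hcard_map
  have := Fact.mk hq
  obtain ⟨H, hHn, hH, hHq⟩ := hG.exists_normal_isPGroup_of_quotient hN hNp
    (hindex.trans (Subgroup.index_dvd_of_le hNR)) hS hSq
  exact hqr (eq_of_prime_dvd_card_of_isPGroup hHq (hdvd H hHn hH)).symm

end CoprimeResidual

section AbelianSubgroupsOfComplement

/-- A simple submodule over `ℤ[B]` has a maximal annihilator, so that `B` embeds into the unit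
group of a field. -/
theorem isCyclic_of_fixedPointFree {B W : Type*} [CommGroup B] [Finite B] [AddCommGroup W]
    [Finite W] [Nontrivial W] (ρ : Representation ℤ B W) (hρ : ∀ b ≠ 1, ∀ w ≠ 0, ρ b w ≠ w) :
    IsCyclic B := by
  have : Finite ρ.asModule := ‹Finite W›
  have : Nontrivial ρ.asModule := ‹Nontrivial W›
  have : Finite (Submodule (MonoidAlgebra ℤ B) ρ.asModule) :=
    Finite.of_injective _ SetLike.coe_injective
  obtain ⟨S, hS⟩ := IsAtomic.exists_atom (Submodule (MonoidAlgebra ℤ B) ρ.asModule)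
  have : IsSimpleModule (MonoidAlgebra ℤ B) S := isSimpleModule_iff_isAtom.2 hS
  let I := Module.annihilator (MonoidAlgebra ℤ B) S
  have : I.IsMaximal := IsSimpleModule.annihilator_isMaximal
  have : IsDomain (MonoidAlgebra ℤ B ⧸ I) := Ideal.Quotient.isDomain I
  refine isCyclic_of_injective_ringHom
    ((Ideal.Quotient.mk I : _ →* MonoidAlgebra ℤ B ⧸ I).comp (MonoidAlgebra.of ℤ B)) ?_
  refine (injective_iff_map_eq_one _).2 fun b hb => by_contra fun hb1 => ?_
  obtain ⟨s, hs, hs0⟩ := S.ne_bot_iff.1 hS.1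
  have hmem : MonoidAlgebra.of ℤ B b - 1 ∈ I := Ideal.Quotient.eq.1 hb
  have hfix := congrArg Subtype.val (Module.mem_annihilator.1 hmem ⟨s, hs⟩)
  rw [sub_smul, one_smul, ZeroMemClass.coe_zero] at hfix
  refine hρ b hb1 s hs0 ?_
  rwa [Submodule.coe_sub, Submodule.coe_smul, sub_eq_zero, MonoidAlgebra.of_apply, ρ.single_smul,
    one_smul] at hfix

open scoped IsMulCommutative in
theorem IsGCStar.isCyclic_of_le_complement {G : Type*} [Group G] [Finite G] [Group.IsSolvable G]
    (hG : IsGCStar G) (hR : nilpotentResidual G ≠ ⊥) {L : Subgroup G}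
    (hL : (nilpotentResidual G).IsComplement' L) {B : Subgroup G} (hBL : B ≤ L)
    [IsMulCommutative B] : IsCyclic B := by
  let _ : MulDistribMulAction G (nilpotentResidual G →* ℂˣ) := conjCharacterAction
  have : Finite (nilpotentResidual G →* ℂˣ) :=
    (nonempty_linearCharacter_equiv_abelianization _).elim fun e => .of_equiv _ e.symm
  have : Nontrivial (nilpotentResidual G) := (Subgroup.nontrivial_iff_ne_bot _).2 hR
  have : Nontrivial (nilpotentResidual G →* ℂˣ) := nontrivial_linearCharacter _
  refine isCyclic_of_fixedPointFree (B := B) (W := Additive (nilpotentResidual G →* ℂˣ))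
    (Representation.ofMulDistribMulAction B (nilpotentResidual G →* ℂˣ)) fun b hb θ hθ hfix => ?_
  have hmoved : ∃ l ∈ L, conjCharacter θ.toMul l ≠ θ.toMul := by
    by_contra! h
    exact hθ <| eq_one_of_forall_conjCharacter_eq commutator_nilpotentResidual_top
      (conjCharacter_eq_of_sup_eq_top hL.sup_eq_top h)
  have hmem : (b : G) ∈ linearCharacterStabilizer L θ.toMul := ⟨hBL b.2, hfix⟩
  rw [hG.linearCharacterStabilizer_eq_bot hL hmoved, Subgroup.mem_bot] at hmem
  exact hb (Subtype.ext hmem)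

end AbelianSubgroupsOfComplement

section CyclicAbelianSubgroups

open scoped commutatorElement

theorem mem_zpowers_of_orderOf_dvd {C : Type*} [CommGroup C] [IsCyclic C] [Finite C] {x y : C}
    (h : orderOf x ∣ orderOf y) : x ∈ Subgroup.zpowers y := by
  have hle : Subgroup.zpowers y ≤ (powMonoidHom (orderOf y) : C →* C).ker :=
    Subgroup.zpowers_le.2 (pow_orderOf_eq_one y)
  have heq := Subgroup.eq_of_le_of_card_ge hle (by
    rw [IsCyclic.card_powMonoidHom_ker, Nat.card_zpowers]
    exact Nat.gcd_le_right _ (orderOf_pos y))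
  rw [heq]
  exact orderOf_dvd_iff_pow_eq_one.1 h

variable {G : Type*} [Group G] {x y : G}

theorem eq_of_mem_zpowers_of_orderOf_eq_two (hy : orderOf y = 2) (hx : x ≠ 1)
    (h : x ∈ Subgroup.zpowers y) : x = y := by
  classical
  have hfin : IsOfFinOrder y := orderOf_pos_iff.1 (by omega)
  obtain ⟨k, hk, rfl⟩ := Finset.mem_image.1 (hfin.mem_zpowers_iff_mem_range_orderOf.1 h)
  rw [hy, Finset.mem_range] at hk
  interval_cases k <;> simp_all

theorem commutatorElement_pow_left (hc : ⁅y, x⁆ ∈ Subgroup.center G) (n : ℕ) :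
    ⁅y ^ n, x⁆ = ⁅y, x⁆ ^ n := by
  have hcomm : Commute y⁻¹ ⁅y, x⁆ := Subgroup.mem_center_iff.1 hc y⁻¹
  calc ⁅y ^ n, x⁆ = y ^ n * (x * y⁻¹ * x⁻¹) ^ n := by
        rw [conj_pow, inv_pow, commutatorElement_def]; simp only [mul_assoc]
    _ = y ^ n * (y⁻¹ * ⁅y, x⁆) ^ n := by simp only [commutatorElement_def]; group
    _ = ⁅y, x⁆ ^ n := by rw [hcomm.mul_pow, inv_pow, mul_inv_cancel_left]

theorem mul_pow_of_commutatorElement_mem_center (hc : ⁅y, x⁆ ∈ Subgroup.center G) (n : ℕ) :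
    (x * y) ^ n = x ^ n * y ^ n * ⁅y, x⁆ ^ n.choose 2 := by
  have hcentral : ∀ k g, ⁅y, x⁆ ^ k * g = g * ⁅y, x⁆ ^ k := fun k g =>
    (Subgroup.mem_center_iff.1 (pow_mem hc k) g).symm
  have hswap : ∀ n : ℕ, y ^ n * x = x * y ^ n * ⁅y, x⁆ ^ n := fun n => by
    rw [← hcentral, ← commutatorElement_pow_left hc, commutatorElement_def]
    group
  induction n with
  | zero => simp
  | succ n ih =>
    calc (x * y) ^ (n + 1) = x ^ n * (y ^ n * x) * y * ⁅y, x⁆ ^ n.choose 2 := by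
          rw [pow_succ, ih, mul_assoc _ _ (x * y), hcentral]; simp only [mul_assoc]
      _ = x ^ (n + 1) * y ^ (n + 1) * ⁅y, x⁆ ^ (n + n.choose 2) := by
          rw [hswap, pow_succ x, pow_succ y, pow_add]
          simp only [mul_assoc, hcentral n]
      _ = x ^ (n + 1) * y ^ (n + 1) * ⁅y, x⁆ ^ (n + 1).choose 2 := by
          rw [Nat.choose_succ_succ' n 1, Nat.choose_one_right]

/-- `x * y ^ m`, with `m` chosen so that `y ^ (p * m)` cancels `x ^ p`, has small order. -/
theorem exists_notMem_center_pow_eq_one {p : ℕ} [Fact p.Prime] [Finite G]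
    (hc : ⁅y, x⁆ ∈ Subgroup.center G) (hcp : ⁅y, x⁆ ^ p = 1) (hne : ⁅y, x⁆ ≠ 1)
    (hxy : x ^ p ∈ Subgroup.zpowers (y ^ p)) :
    ∃ u ∉ Subgroup.center G, u ^ p = 1 ∨ p = 2 ∧ u ^ 4 = 1 := by
  obtain ⟨m, hm⟩ := mem_powers_iff_mem_zpowers.2 (inv_mem hxy)
  have hcm : ⁅y ^ m, x⁆ = ⁅y, x⁆ ^ m := commutatorElement_pow_left hc m
  have hpow : (x * y ^ m) ^ p = (⁅y, x⁆ ^ m) ^ p.choose 2 := by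
    rw [mul_pow_of_commutatorElement_mem_center (hcm ▸ pow_mem hc m), hcm, ← pow_mul y, mul_comm m,
      pow_mul]
    simp only at hm
    rw [hm, mul_inv_cancel, one_mul]
  refine ⟨x * y ^ m, fun hu => hne ?_, ?_⟩
  · have hcomm := Subgroup.mem_center_iff.1 hu y
    rw [← mul_assoc, mul_assoc x, ← pow_succ, pow_succ', ← mul_assoc, mul_left_inj] at hcomm
    exact commutatorElement_eq_one_iff_mul_comm.2 hcomm
  · by_cases hp : p = 2
    · subst hp
      refine .inr ⟨rfl, ?_⟩
      rw [pow_mul _ 2 2, hpow, Nat.choose_self, pow_one, pow_right_comm, hcp, one_pow]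
    · obtain ⟨c, hc⟩ := (Fact.out : p.Prime).dvd_choose_self two_ne_zero
        (lt_of_le_of_ne (Fact.out : p.Prime).two_le (Ne.symm hp))
      rw [hpow, hc, ← pow_mul, ← mul_assoc, mul_comm m, mul_assoc, pow_mul, hcp, one_pow]
      exact .inl rfl

variable [Finite G]

theorem mem_zpowers_of_commute_of_orderOf_dvd
    (hcyc : ∀ B : Subgroup G, IsMulCommutative B → IsCyclic B) (hxy : Commute x y)
    (h : orderOf x ∣ orderOf y) : x ∈ Subgroup.zpowers y := by
  have hcomm : IsMulCommutative (Subgroup.closure {x, y}) := by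
    apply Subgroup.isMulCommutative_closure
    rintro a (rfl | rfl) b (rfl | rfl) <;> simp [hxy.eq]
  have := hcyc _ hcomm
  let _ : CommGroup (Subgroup.closure {x, y}) := IsCyclic.commGroup
  have hmem := mem_zpowers_of_orderOf_dvd (C := Subgroup.closure {x, y})
    (x := ⟨x, Subgroup.subset_closure (by simp)⟩) (y := ⟨y, Subgroup.subset_closure (by simp)⟩)
    (by simpa only [Subgroup.orderOf_mk] using h)
  obtain ⟨k, hk⟩ := Subgroup.mem_zpowers_iff.1 hmem
  exact Subgroup.mem_zpowers_iff.2 ⟨k, congrArg Subtype.val hk⟩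

variable {p : ℕ} [Fact p.Prime]

theorem mem_zpowers_or_mem_zpowers_of_commute (hp : IsPGroup p G)
    (hcyc : ∀ B : Subgroup G, IsMulCommutative B → IsCyclic B) (hxy : Commute x y) :
    x ∈ Subgroup.zpowers y ∨ y ∈ Subgroup.zpowers x := by
  obtain ⟨i, hi⟩ := IsPGroup.iff_orderOf.1 hp x
  obtain ⟨j, hj⟩ := IsPGroup.iff_orderOf.1 hp y
  refine (le_total i j).imp (fun h => mem_zpowers_of_commute_of_orderOf_dvd hcyc hxy ?_)
    fun h => mem_zpowers_of_commute_of_orderOf_dvd hcyc hxy.symm ?_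
  all_goals rw [hi, hj]; exact pow_dvd_pow p h

theorem mem_center_of_pow_eq_one (hp : IsPGroup p G)
    (hcyc : ∀ B : Subgroup G, IsMulCommutative B → IsCyclic B) (hx : x ^ p = 1) :
    x ∈ Subgroup.center G := by
  cases subsingleton_or_nontrivial G
  · simp [Subsingleton.elim x 1]
  have := hp.center_nontrivial
  obtain ⟨⟨z, hz⟩, hzp⟩ := exists_prime_orderOf_dvd_card' p
    ((hp.to_subgroup (Subgroup.center G)).card_eq_or_dvd.resolve_left Finite.one_lt_card.ne')
  rw [Subgroup.orderOf_mk] at hzp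
  exact Subgroup.zpowers_le.2 hz (mem_zpowers_of_commute_of_orderOf_dvd hcyc
    (Subgroup.mem_center_iff.1 hz x) (hzp ▸ orderOf_dvd_of_pow_eq_one hx))

theorem exists_notMem_center_commutatorElement_mem_center (hp : IsPGroup p G)
    (hG : ¬ IsMulCommutative G) : ∃ w ∉ Subgroup.center G,
      w ^ p ∈ Subgroup.center G ∧ ∀ g, ⁅w, g⁆ ∈ Subgroup.center G := by
  let Q := G ⧸ Subgroup.center G
  have hQ : IsPGroup p Q := hp.to_quotient _
  have : Nontrivial Q := QuotientGroup.nontrivial_iff.2 fun h => hG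
    ⟨⟨fun a b => Subgroup.mem_center_iff.1 (h ▸ Subgroup.mem_top b) a⟩⟩
  have := hQ.center_nontrivial
  obtain ⟨⟨x, hx⟩, hxp⟩ := exists_prime_orderOf_dvd_card' p
    ((hQ.to_subgroup (Subgroup.center Q)).card_eq_or_dvd.resolve_left Finite.one_lt_card.ne')
  obtain ⟨w, rfl⟩ := QuotientGroup.mk_surjective x
  rw [Subgroup.orderOf_mk] at hxp
  refine ⟨w, fun hw => ?_, ?_, fun g => ?_⟩
  · rw [(QuotientGroup.eq_one_iff w).2 hw, orderOf_one] at hxp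
    exact (Fact.out : p.Prime).one_lt.ne hxp
  · rw [← QuotientGroup.eq_one_iff, QuotientGroup.mk_pow, ← hxp, pow_orderOf_eq_one]
  · rw [← QuotientGroup.eq_one_iff]
    exact commutatorElement_eq_one_iff_mul_comm.2 (Subgroup.mem_center_iff.1 hx g).symm

theorem eq_two_and_exists_pow_four_eq_one (hp : IsPGroup p G)
    (hcyc : ∀ B : Subgroup G, IsMulCommutative B → IsCyclic B) (hG : ¬ IsMulCommutative G) :
    p = 2 ∧ ∃ u ∉ Subgroup.center G, u ^ 4 = 1 := by
  obtain ⟨w, hw, hwp, hwc⟩ := exists_notMem_center_commutatorElement_mem_center hp hG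
  obtain ⟨g, hg⟩ : ∃ g : G, ⁅w, g⁆ ≠ 1 := by
    by_contra! h
    exact hw (Subgroup.mem_center_iff.2 fun g =>
      (commutatorElement_eq_one_iff_mul_comm.1 (h g)).symm)
  have hcp : ⁅w, g⁆ ^ p = 1 := by
    rw [← commutatorElement_pow_left (hwc g), commutatorElement_eq_one_iff_mul_comm]
    exact (Subgroup.mem_center_iff.1 hwp g).symm
  have hu : ∃ u ∉ Subgroup.center G, u ^ p = 1 ∨ p = 2 ∧ u ^ 4 = 1 := by
    rcases mem_zpowers_or_mem_zpowers_of_commute hp hcyc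
      (Subgroup.mem_center_iff.1 hwp (g ^ p)) with h | h
    · exact exists_notMem_center_pow_eq_one (hwc g) hcp hg h
    · rw [← commutatorElement_inv] at hcp hg
      rw [inv_pow, inv_eq_one] at hcp
      exact exists_notMem_center_pow_eq_one
        (commutatorElement_inv w g ▸ inv_mem (hwc g)) hcp (inv_ne_one.1 hg) h
  obtain ⟨u, huZ, hu | hu⟩ := hu
  · exact absurd (mem_center_of_pow_eq_one hp hcyc hu) huZ
  · exact ⟨hu.1, u, huZ, hu.2⟩

theorem sq_eq_one_of_mem_center (hp : IsPGroup p G)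
    (hcyc : ∀ B : Subgroup G, IsMulCommutative B → IsCyclic B) (hG : ¬ IsMulCommutative G)
    (hx : x ∈ Subgroup.center G) : x ^ 2 = 1 := by
  obtain ⟨rfl, u, huZ, hu⟩ := eq_two_and_exists_pow_four_eq_one hp hcyc hG
  obtain ⟨k, hk⟩ := IsPGroup.iff_orderOf.1 hp x
  rw [← orderOf_dvd_iff_pow_eq_one, hk]
  refine pow_dvd_pow 2 (n := 1) (not_lt.1 fun h => huZ ?_)
  refine Subgroup.zpowers_le.2 hx (mem_zpowers_of_commute_of_orderOf_dvd hcyc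
    (Subgroup.mem_center_iff.1 hx u) ?_)
  exact (orderOf_dvd_of_pow_eq_one hu).trans (hk ▸ pow_dvd_pow 2 (m := 2) h)

end CyclicAbelianSubgroups

section GeneralizedQuaternion

open scoped commutatorElement

variable {G : Type*} [Group G]

theorem index_centralizer_eq_two {w : G} (hw : w ∉ Subgroup.center G)
    (hconj : ∀ g, g * w * g⁻¹ = w ∨ g * w * g⁻¹ = w⁻¹) :
    (Subgroup.centralizer {w}).index = 2 := by
  have hmem : ∀ g, g ∈ Subgroup.centralizer {w} ↔ g * w * g⁻¹ = w := fun g => by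
    rw [Subgroup.mem_centralizer_singleton_iff, mul_inv_eq_iff_eq_mul]
  obtain ⟨l, hl⟩ : ∃ l, l ∉ Subgroup.centralizer {w} := by
    by_contra! h
    exact hw (Subgroup.mem_center_iff.2 fun g => Subgroup.mem_centralizer_singleton_iff.1 (h g))
  refine Subgroup.index_eq_two_iff.2 ⟨l, fun g => ?_⟩
  have hlw : l * w * l⁻¹ = w⁻¹ := (hconj l).resolve_left (hl <| (hmem l).2 ·)
  by_cases hg : g ∈ Subgroup.centralizer {w}
  · exact .inr ⟨hg, fun h => hl ((Subgroup.mul_mem_cancel_left _ hg).1 h)⟩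
  · refine .inl ⟨(hmem _).2 ?_, hg⟩
    have hgw : g * w * g⁻¹ = w⁻¹ := (hconj g).resolve_left (hg <| (hmem g).2 ·)
    calc g * l * w * (g * l)⁻¹ = g * (l * w * l⁻¹) * g⁻¹ := by group
      _ = w := by rw [hlw, ← conj_inv, hgw, inv_inv]

theorem sq_mem_center_of_index_eq_two {C : Subgroup G} [IsMulCommutative C] (hC : C.index = 2)
    {g : G} (hg : g ∉ C) : g ^ 2 ∈ Subgroup.center G := by
  have hsq : g ^ 2 ∈ C := Subgroup.sq_mem_of_index_two hC g
  have hcomm : ∀ c ∈ C, c * g ^ 2 = g ^ 2 * c := fun c hc =>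
    congrArg Subtype.val (mul_comm' (⟨c, hc⟩ : C) ⟨_, hsq⟩)
  refine Subgroup.mem_center_iff.2 fun x => ?_
  by_cases hx : x ∈ C
  · exact hcomm x hx
  · have hgx : g⁻¹ * x ∈ C :=
      (Subgroup.mul_mem_iff_of_index_two hC).2 (by simp [hg, hx])
    calc x * g ^ 2 = g * (g⁻¹ * x * g ^ 2) := by group
      _ = g ^ 2 * x := by rw [hcomm _ hgx]; group

/-- The homomorphism from a generalized quaternion group determined by the images of the cyclic
subgroup of the `a i` and of the element `xa 0`. -/
def quaternionGroupHom {n : ℕ} (f : Multiplicative (ZMod (2 * n)) →* G) {x : G}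
    (hx : x ^ 2 = f (.ofAdd n)) (hfx : ∀ i, f i * x = x * f i⁻¹) : QuaternionGroup n →* G :=
  MonoidHom.mk' (fun
    | .a i => f (.ofAdd i)
    | .xa i => x * f (.ofAdd i)) <| by
    rintro (i | i) (j | j)
    · exact map_mul f _ _
    · simp only [QuaternionGroup.a_mul_xa, ofAdd_sub]
      rw [← mul_assoc, hfx, mul_assoc, ← map_mul, inv_mul_eq_div]
    · simp only [QuaternionGroup.xa_mul_a, ofAdd_add]
      rw [map_mul, mul_assoc]
    · simp only [QuaternionGroup.xa_mul_xa]
      rw [mul_assoc, ← mul_assoc (f _), hfx, mul_assoc, ← mul_assoc x, ← sq, hx, ← map_mul,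
        ← map_mul, inv_mul_eq_div, ← ofAdd_sub, ← ofAdd_add, add_sub_assoc]

theorem bijective_quaternionGroupHom {C : Subgroup G} (hC : C.index = 2) {n : ℕ} [NeZero n]
    (e : Multiplicative (ZMod (2 * n)) ≃* C) {x : G} (hxC : x ∉ C)
    (hx : x ^ 2 = (C.subtype.comp e.toMonoidHom) (.ofAdd n)) (hfx) :
    Function.Bijective (quaternionGroupHom (C.subtype.comp e.toMonoidHom) hx hfx) := by
  have hsurj : Function.Surjective
      (quaternionGroupHom (C.subtype.comp e.toMonoidHom) hx hfx) := fun g => by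
    by_cases hg : g ∈ C
    · exact ⟨.a (e.symm ⟨g, hg⟩).toAdd, congrArg Subtype.val (e.apply_symm_apply ⟨g, hg⟩)⟩
    · have hxg : x⁻¹ * g ∈ C := (Subgroup.mul_mem_iff_of_index_two hC).2 (by simp [hxC, hg])
      refine ⟨.xa (e.symm ⟨_, hxg⟩).toAdd, ?_⟩
      exact (congrArg (x * ·) (congrArg Subtype.val (e.apply_symm_apply ⟨_, hxg⟩))).trans
        (mul_inv_cancel_left x g)
  refine hsurj.bijective_of_nat_card_le ?_
  rw [Nat.card_eq_fintype_card, QuaternionGroup.card, ← C.card_mul_index, hC,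
    ← Nat.card_congr e.toEquiv, Nat.card_congr Multiplicative.toAdd, Nat.card_zmod]
  lia

variable [Finite G]

theorem exists_mulEquiv_quaternionGroup_of_index_eq_two {C : Subgroup G} [IsCyclic C]
    (hC : C.index = 2) {s : G} (hs : orderOf s = 2) (hsq : ∀ g ∉ C, g ^ 2 = s) :
    ∃ n, n ≠ 0 ∧ Nonempty (G ≃* QuaternionGroup n) := by
  obtain ⟨x, hx⟩ : ∃ x, x ∉ C := by
    by_contra! h
    simp [(Subgroup.eq_top_iff' C).2 h] at hC
  have hsC : s ∈ C := hsq x hx ▸ Subgroup.sq_mem_of_index_two hC x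
  obtain ⟨n, hn⟩ : 2 ∣ Nat.card C := by
    rw [← hs, ← Subgroup.orderOf_mk s hsC]
    exact orderOf_dvd_natCard _
  have hn0 : n ≠ 0 := fun h => Nat.card_pos.ne' (by rw [hn, h])
  have : NeZero n := ⟨hn0⟩
  let _ : CommGroup C := IsCyclic.commGroup
  obtain ⟨e⟩ : Nonempty (Multiplicative (ZMod (2 * n)) ≃* C) := by
    rw [← hn]
    exact ⟨zmodCyclicMulEquiv ‹IsCyclic C›⟩
  have hen : orderOf (e (.ofAdd (n : ZMod (2 * n)))) = 2 := by
    rw [MulEquiv.orderOf_eq, orderOf_ofAdd_eq_addOrderOf, ZMod.addOrderOf_coe _ (by lia),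
      Nat.gcd_mul_left_left, Nat.mul_div_cancel _ (by lia)]
  have hse : s = e (.ofAdd (n : ZMod (2 * n))) := by
    have hsc : orderOf (⟨s, hsC⟩ : C) = 2 := by rwa [Subgroup.orderOf_mk]
    exact congrArg Subtype.val (eq_of_mem_zpowers_of_orderOf_eq_two hen
      (orderOf_eq_one_iff.not.1 (hsc.trans_ne (by decide)))
      (mem_zpowers_of_orderOf_dvd (by rw [hsc, hen])))
  have hfx : ∀ i, C.subtype (e i) * x = x * C.subtype (e i⁻¹) := fun i => by
    have hxi : x * e i ∉ C := by rwa [Subgroup.mul_mem_cancel_right _ (e i).2]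
    have hsq_eq := (hsq _ hxi).trans (hsq x hx).symm
    rw [sq, sq, mul_assoc, mul_right_inj, ← mul_assoc] at hsq_eq
    rw [map_inv, map_inv]
    exact eq_mul_inv_of_mul_eq hsq_eq
  exact ⟨n, hn0, ⟨(MulEquiv.ofBijective _
    (bijective_quaternionGroupHom hC e hx ((hsq x hx).trans hse) hfx)).symm⟩⟩

theorem isMulCommutative_centralizer {p : ℕ} [Fact p.Prime] (hp : IsPGroup p G)
    (hcyc : ∀ B : Subgroup G, IsMulCommutative B → IsCyclic B) {w : G} (hw : w ^ 2 ≠ 1) :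
    IsMulCommutative (Subgroup.centralizer {w}) := by
  by_contra hC
  have hcycC : ∀ B : Subgroup (Subgroup.centralizer {w}), IsMulCommutative B → IsCyclic B :=
    fun B _ => (B.equivMapOfInjective _ (Subgroup.subtype_injective _)).isCyclic.2
      (hcyc (B.map (Subgroup.centralizer {w}).subtype) inferInstance)
  have hcenter : ⟨w, Subgroup.mem_centralizer_singleton_iff.2 rfl⟩ ∈
      Subgroup.center (Subgroup.centralizer {w}) :=
    Subgroup.mem_center_iff.2 fun g =>
      Subtype.ext (Subgroup.mem_centralizer_singleton_iff.1 g.2)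
  exact hw (congrArg Subtype.val (sq_eq_one_of_mem_center (hp.to_subgroup _) hcycC hC hcenter))

theorem exists_isCyclic_index_eq_two {p : ℕ} [Fact p.Prime] (hp : IsPGroup p G)
    (hcyc : ∀ B : Subgroup G, IsMulCommutative B → IsCyclic B) (hG : ¬ IsMulCommutative G) :
    ∃ C : Subgroup G, IsCyclic C ∧ C.index = 2 ∧
      ∃ s : G, orderOf s = 2 ∧ ∀ g ∉ C, g ^ 2 = s := by
  obtain ⟨rfl, -⟩ := eq_two_and_exists_pow_four_eq_one hp hcyc hG
  obtain ⟨w, hw, hwsq, hwc⟩ := exists_notMem_center_commutatorElement_mem_center hp hG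
  have hw1 : w ^ 2 ≠ 1 := fun h => hw (mem_center_of_pow_eq_one hp hcyc h)
  have hw4 : (w ^ 2) ^ 2 = 1 := sq_eq_one_of_mem_center hp hcyc hG hwsq
  have hs : orderOf (w ^ 2) = 2 := orderOf_eq_prime hw4 hw1
  have hcenter : ∀ z ∈ Subgroup.center G, z = 1 ∨ z = w ^ 2 := fun z hz => by
    refine or_iff_not_imp_left.2 fun hz1 => eq_of_mem_zpowers_of_orderOf_eq_two hs hz1 ?_
    refine mem_zpowers_of_commute_of_orderOf_dvd hcyc (Subgroup.mem_center_iff.1 hwsq z) ?_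
    rw [hs]
    exact orderOf_dvd_of_pow_eq_one (sq_eq_one_of_mem_center hp hcyc hG hz)
  have hconj : ∀ g, g * w * g⁻¹ = w ∨ g * w * g⁻¹ = w⁻¹ := fun g => by
    have hgw : g * w * g⁻¹ = ⁅w, g⁆⁻¹ * w := by rw [commutatorElement_def]; group
    rcases hcenter _ (inv_mem (hwc g)) with h | h
    · exact .inl (by rw [hgw, h, one_mul])
    · refine .inr (hgw.trans (eq_inv_of_mul_eq_one_left ?_))
      rw [h, mul_assoc, ← sq, ← sq, hw4]
  have hcomm := isMulCommutative_centralizer hp hcyc hw1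
  have hindex := index_centralizer_eq_two hw hconj
  refine ⟨_, hcyc _ hcomm, hindex, w ^ 2, hs, fun g hg => ?_⟩
  refine (hcenter _ (sq_mem_center_of_index_eq_two hindex hg)).resolve_left fun hg1 => hg ?_
  exact Subgroup.center_le_centralizer _ (mem_center_of_pow_eq_one hp hcyc hg1)

end GeneralizedQuaternion

section QuaternionRepresentations

open Module
open scoped commutatorElement

theorem apply_eq_one_of_finrank_eq_one {k G V : Type*} [Field k] [Group G] [AddCommGroup V]
    [Module k V] (ρ : Representation k G V) (h : finrank k V = 1) {g : G} (hg : g ∈ commutator G) :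
    ρ g = 1 := by
  obtain ⟨μ, hμ⟩ := exists_apply_eq_smul_of_finrank_eq_one ρ h
  exact LinearMap.ext fun v => by
    rw [hμ, eq_one_of_mem_commutator μ hg, Units.val_one, one_smul, Module.End.one_apply]

theorem finrank_le_index {k G V : Type*} [Field k] [Group G] [AddCommGroup V] [Module k V]
    {ρ : Representation k G V} (hρ : ρ.IsIrreducible) (H : Subgroup G) [H.FiniteIndex] {v : V}
    (hv : v ≠ 0) (hH : ∀ h ∈ H, ∃ c : k, ρ h v = c • v) : finrank k V ≤ H.index := by
  have := Fintype.ofFinite (G ⧸ H)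
  let U := Submodule.span k (Set.range fun q : G ⧸ H => ρ q.out v)
  have hmem : ∀ g, ρ g v ∈ U := fun g => by
    obtain ⟨h, hh⟩ := QuotientGroup.mk_out_eq_mul H g
    obtain ⟨c, hc⟩ := hH _ (inv_mem h.2)
    have hg : ρ g v = c • ρ (g : G ⧸ H).out v := by
      rw [← map_smul, ← hc, ← Module.End.mul_apply, ← map_mul, hh, mul_inv_cancel_right]
    exact hg ▸ U.smul_mem c (Submodule.subset_span ⟨_, rfl⟩)
  have hU : U = ⊤ := by
    refine (eq_bot_or_eq_top_of_stable hρ fun g u hu => ?_).resolve_left fun h => hv ?_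
    · induction hu using Submodule.span_induction with
      | mem u hu =>
        obtain ⟨q, rfl⟩ := hu
        simp only [← Module.End.mul_apply, ← map_mul, hmem]
      | zero => simp
      | add u w _ _ hu hw => simpa using add_mem hu hw
      | smul c u _ hu => simpa using U.smul_mem c hu
    · simpa [h] using hmem 1
  calc finrank k V = finrank k U := by rw [hU, finrank_top]
    _ ≤ Fintype.card (G ⧸ H) := finrank_range_le_card _
    _ = H.index := (Subgroup.index_eq_card H ▸ Nat.card_eq_fintype_card).symm

theorem finrank_le_two_of_quaternionGroup {k V : Type*} [Field k] [IsAlgClosed k]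
    [AddCommGroup V] [Module k V] [FiniteDimensional k V] {n : ℕ} (hn : n ≠ 0)
    {ρ : Representation k (QuaternionGroup n) V} (hρ : ρ.IsIrreducible) : finrank k V ≤ 2 := by
  have : NeZero n := ⟨hn⟩
  have := nontrivial_of_isIrreducible hρ
  obtain ⟨c, hc⟩ := End.exists_eigenvalue (ρ (.a 1))
  obtain ⟨v, hv⟩ := hc.exists_hasEigenvector
  have hindex : (Subgroup.zpowers (.a 1 : QuaternionGroup n)).index = 2 := by
    have := (Subgroup.zpowers (.a 1 : QuaternionGroup n)).card_mul_index
    rw [Nat.card_zpowers, QuaternionGroup.orderOf_a_one, Nat.card_eq_fintype_card,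
      QuaternionGroup.card] at this
    exact Nat.eq_of_mul_eq_mul_left (by lia) (this.trans (by lia))
  refine hindex ▸ finrank_le_index hρ _ hv.2 fun h hh => ?_
  obtain ⟨i, rfl⟩ := mem_powers_iff_mem_zpowers.2 hh
  exact ⟨c ^ i, by rw [map_pow, hv.pow_apply]⟩

theorem quaternionGroup_a_mem_center (n : ℕ) :
    .a n ∈ Subgroup.center (QuaternionGroup n) := by
  have hneg : (-n : ZMod (2 * n)) = n := by
    rw [neg_eq_iff_add_eq_zero, ← two_mul]
    exact_mod_cast ZMod.natCast_self (2 * n)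
  refine Subgroup.mem_center_iff.2 ?_
  rintro (i | i)
  · rw [QuaternionGroup.a_mul_a, QuaternionGroup.a_mul_a, add_comm]
  · rw [QuaternionGroup.a_mul_xa, QuaternionGroup.xa_mul_a, sub_eq_add_neg, hneg]

theorem dvd_two_of_commutator_quaternionGroup_le {n : ℕ}
    (h : commutator (QuaternionGroup n) ≤ Subgroup.zpowers (.a n)) : n ∣ 2 := by
  have hcomm : ⁅(.a 1 : QuaternionGroup n), (.xa 0 : QuaternionGroup n)⁆ = .a 1 ^ 2 := by
    rw [commutatorElement_def, mul_inv_eq_iff_eq_mul, mul_inv_eq_iff_eq_mul,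
      QuaternionGroup.a_one_pow]
    simp only [QuaternionGroup.a_mul_xa, QuaternionGroup.xa_mul_a]
    congr 1
    push_cast
    ring
  obtain ⟨k, hk⟩ := Subgroup.mem_zpowers_iff.1 (h (Subgroup.commutator_mem_commutator
    (Subgroup.mem_top (.a 1 : QuaternionGroup n)) (Subgroup.mem_top (.xa 0))))
  have hsq : (.a n : QuaternionGroup n) ^ 2 = 1 := by
    rw [← QuaternionGroup.xa_sq 0, ← pow_mul, QuaternionGroup.xa_pow_four]
  have hpow : (.a 1 : QuaternionGroup n) ^ (2 * 2) = 1 := by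
    rw [pow_mul, ← hcomm, ← hk, ← zpow_natCast, ← zpow_mul, mul_comm k, zpow_mul, zpow_natCast,
      hsq, one_zpow]
  exact Nat.dvd_of_mul_dvd_mul_left two_pos
    (QuaternionGroup.orderOf_a_one ▸ orderOf_dvd_of_pow_eq_one hpow)

theorem IsGCStar.dvd_two_of_quaternionGroup {n : ℕ} (hn : n ≠ 0)
    (hG : IsGCStar (QuaternionGroup n)) : n ∣ 2 := by
  have : NeZero n := ⟨hn⟩
  let S := Subgroup.zpowers (.a n : QuaternionGroup n)
  have : S.Normal := ⟨fun x hx g => by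
    have hxZ := Subgroup.zpowers_le.2 (quaternionGroup_a_mem_center n) hx
    rwa [Subgroup.mem_center_iff.1 hxZ g, mul_inv_cancel_right]⟩
  refine dvd_two_of_commutator_quaternionGroup_le (not_not.1 fun hS => ?_)
  have hzS : (.a n : QuaternionGroup n) ∈ S := Subgroup.mem_zpowers _
  have hz : (.a n : QuaternionGroup n) ≠ 1 := by
    rw [← QuaternionGroup.a_one_pow]
    exact pow_ne_one_of_lt_orderOf hn (by rw [QuaternionGroup.orderOf_a_one]; lia)
  have hfinrank : ∀ {d : ℕ} {ρ : Representation ℂ (QuaternionGroup n) (Fin d → ℂ)},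
      ρ.IsIrreducible → finrank ℂ (Fin d → ℂ) ≠ 1 → finrank ℂ (Fin d → ℂ) = 2 :=
    fun hρ hne => by
      have := nontrivial_of_isIrreducible hρ
      exact (finrank_le_two_of_quaternionGroup hn hρ).antisymm
        (Nat.lt_of_le_of_ne finrank_pos hne.symm)
  obtain ⟨d, ρ, hρ, hne, hker⟩ := exists_isIrreducible_finrank_ne_one_of_not_commutator_le S hS
  obtain ⟨m, σ, hσ, hσz⟩ := exists_isIrreducible_apply_ne_one hz
  have hσ_ne : finrank ℂ (Fin m → ℂ) ≠ 1 := fun h => hσz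
    (apply_eq_one_of_finrank_eq_one σ h (hG.le_commutator_of_not_commutator_le S hS hzS))
  exact hσz (hG.apply_eq_one_of_apply_eq_one hρ hσ hne
    ((hfinrank hρ hne).trans (hfinrank hσ hσ_ne).symm) hker _ hzS)

theorem IsGCStar.nonempty_mulEquiv_quaternionGroup {G : Type*} [Group G] [Finite G]
    (hG : IsGCStar G) {p : ℕ} [Fact p.Prime] (hp : IsPGroup p G)
    (hcyc : ∀ B : Subgroup G, IsMulCommutative B → IsCyclic B) (hnc : ¬ IsMulCommutative G) :
    Nonempty (G ≃* QuaternionGroup 2) := by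
  obtain ⟨C, hC, hindex, s, hs, hsq⟩ := exists_isCyclic_index_eq_two hp hcyc hnc
  obtain ⟨n, hn, ⟨e⟩⟩ := exists_mulEquiv_quaternionGroup_of_index_eq_two hindex hs hsq
  have hQ : IsGCStar (QuaternionGroup n) := hG.of_surjective (f := e.toMonoidHom) e.surjective
  rcases (Nat.dvd_prime Nat.prime_two).1 (hQ.dvd_two_of_quaternionGroup hn) with rfl | rfl
  · have := e.isCyclic.2 QuaternionGroup.quaternionGroup_one_isCyclic
    exact absurd (inferInstance : IsMulCommutative G) hnc
  · exact ⟨e⟩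

end QuaternionRepresentations

section NilpotentGroups

open scoped commutatorElement

variable {G : Type*} [Group G]

theorem eq_top_of_commutator_sup_eq_top [Group.IsSolvable G] {N : Subgroup G} [N.Normal]
    (h : commutator G ⊔ N = ⊤) : N = ⊤ := by
  by_contra hN
  have : Nontrivial (G ⧸ N) := QuotientGroup.nontrivial_iff.2 hN
  have hsurj := QuotientGroup.mk'_surjective N
  refine (Group.IsSolvable.commutator_lt_top_of_nontrivial (G ⧸ N)).ne ?_
  calc commutator (G ⧸ N) = (commutator G ⊔ N).map (QuotientGroup.mk' N) := by
        rw [Subgroup.map_sup, QuotientGroup.map_mk'_self, sup_bot_eq, commutator_def,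
          commutator_def, Subgroup.map_commutator, Subgroup.map_top_of_surjective _ hsurj]
    _ = ⊤ := by rw [h, Subgroup.map_top_of_surjective _ hsurj]

variable [Finite G]

theorem eq_top_of_forall_exists_sylow_le {H : Subgroup G}
    (h : ∀ (p : ℕ) [Fact p.Prime], ∃ P : Sylow p G, (P : Subgroup G) ≤ H) : H = ⊤ := by
  rw [← Subgroup.index_eq_one]
  by_contra hne
  obtain ⟨p, hp, hdvd⟩ := Nat.exists_prime_and_dvd hne
  have := Fact.mk hp
  obtain ⟨P, hP⟩ := h p
  exact P.not_dvd_index (hdvd.trans (Subgroup.index_dvd_of_le hP))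

variable [Group.IsNilpotent G] {p : ℕ} [Fact p.Prime]

theorem sylow_le_center (P : Sylow p G) [IsMulCommutative (P : Subgroup G)] :
    (P : Subgroup G) ≤ Subgroup.center G := by
  refine Subgroup.centralizer_eq_top_iff_subset.1 (eq_top_of_forall_exists_sylow_le fun q _ => ?_)
  by_cases hpq : p = q
  · subst hpq
    exact ⟨P, Subgroup.le_centralizer _⟩
  · have Q : Sylow q G := default
    exact ⟨Q, fun y hy => Subgroup.mem_centralizer_iff.2 fun x hx =>
      Subgroup.commute_of_normal_of_disjoint (P : Subgroup G) Q inferInstance inferInstance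
        (IsPGroup.disjoint_of_ne p q hpq _ _ P.2 Q.2) x y hx hy⟩

theorem exists_sylow_not_isMulCommutative (hnc : ¬ IsMulCommutative G) :
    ∃ (p : ℕ) (_ : Fact p.Prime) (P : Sylow p G), ¬ IsMulCommutative (P : Subgroup G) := by
  by_contra! hcomm
  have htop : Subgroup.center G = ⊤ := eq_top_of_forall_exists_sylow_le fun p hp =>
    have := hcomm p hp default
    ⟨default, sylow_le_center default⟩
  exact hnc ⟨⟨fun a b => Subgroup.mem_center_iff.1 (htop ▸ Subgroup.mem_top b) a⟩⟩

/-- A Sylow subgroup for a prime other than `p` lies in `commutator G`, as otherwise it would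
contain `commutator G`, which meets `P` nontrivially. -/
theorem IsGCStar.isPGroup_of_not_isMulCommutative_sylow (hG : IsGCStar G) {P : Sylow p G}
    (hP : ¬ IsMulCommutative (P : Subgroup G)) : IsPGroup p G := by
  have hsup : commutator G ⊔ (P : Subgroup G) = ⊤ := by
    refine eq_top_of_forall_exists_sylow_le fun q _ => ?_
    by_cases hpq : p = q
    · subst hpq
      exact ⟨P, le_sup_right⟩
    · have Q : Sylow q G := default
      refine ⟨Q, le_sup_of_le_left (hG.le_commutator_of_not_commutator_le _ fun hQ => hP ?_)⟩
      refine ⟨⟨fun x y => Subtype.ext (commutatorElement_eq_one_iff_mul_comm.1 ?_)⟩⟩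
      exact Subgroup.disjoint_def.1 (IsPGroup.disjoint_of_ne p q hpq _ _ P.2 Q.2) ⁅x, y⁆.2
        (hQ (Subgroup.commutator_mem_commutator (Subgroup.mem_top _) (Subgroup.mem_top _)))
  have hPtop : (P : Subgroup G) = ⊤ := eq_top_of_commutator_sup_eq_top hsup
  exact (hPtop ▸ P.2 : IsPGroup p (⊤ : Subgroup G)).of_equiv Subgroup.topEquiv

theorem IsGCStar.isCyclic_or_nonempty_mulEquiv (hG : IsGCStar G)
    (hcyc : ∀ B : Subgroup G, IsMulCommutative B → IsCyclic B) :
    IsCyclic G ∨ Nonempty (G ≃* QuaternionGroup 2) := by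
  by_cases hc : IsMulCommutative G
  · exact .inl (Subgroup.topEquiv.isCyclic.1 (hcyc ⊤ inferInstance))
  · obtain ⟨p, hp, P, hP⟩ := exists_sylow_not_isMulCommutative hc
    exact .inr (hG.nonempty_mulEquiv_quaternionGroup
      (hG.isPGroup_of_not_isMulCommutative_sylow hP) hcyc hc)

end NilpotentGroups

section FrobeniusGroups

variable {G : Type*} [Group G] {R L : Subgroup G}

theorem exists_retraction_of_isComplement' [R.Normal] (h : R.IsComplement' L) :
    ∃ f : G →* L, f.ker = R ∧ ∀ l : L, f l = l :=
  ⟨h.symm.QuotientMulEquiv.toMonoidHom.comp (QuotientGroup.mk' R), by ext; simp,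
    h.symm.QuotientMulEquiv.apply_symm_apply⟩

theorem forall_exists_conj_eq_mul_iff [Finite R] {t : G} (ht : ∀ c ∈ R, t * c * t⁻¹ ∈ R) :
    (∀ k ∈ R, ∃ c ∈ R, c * t * c⁻¹ = k * t) ↔ ∀ k ∈ R, Commute k t → k = 1 := by
  let φ : R → R := fun c => ⟨c * (t * (c : G)⁻¹ * t⁻¹), mul_mem c.2 (ht _ (inv_mem c.2))⟩
  have hφ : ∀ c k : R, φ c = k ↔ c * t * (c : G)⁻¹ = k * t := fun c k => by
    rw [Subtype.ext_iff, ← mul_inv_eq_iff_eq_mul]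
    simp only [φ, mul_assoc]
  have hsurj : (∀ k ∈ R, ∃ c ∈ R, c * t * c⁻¹ = k * t) ↔ Function.Surjective φ := by
    simp only [Function.Surjective, hφ, Subtype.forall, Subtype.exists, exists_prop]
  rw [hsurj, ← Finite.injective_iff_surjective]
  refine ⟨fun hinj k hk hkt => ?_, fun hfix c d hcd => ?_⟩
  · have hφk : φ ⟨k, hk⟩ = 1 := (hφ _ _).2 (by simp [hkt.eq])
    have hφ1 : φ 1 = 1 := (hφ _ _).2 (by simp)
    exact congrArg Subtype.val (hinj (hφk.trans hφ1.symm))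
  · have hconj : (c : G) * t * (c : G)⁻¹ = d * t * (d : G)⁻¹ :=
      ((hφ c (φ d)).1 hcd).trans ((hφ d _).1 rfl).symm
    have hcomm : Commute ((d : G)⁻¹ * c) t := by
      rw [commute_iff_eq, mul_assoc, inv_mul_eq_iff_eq_mul, mul_inv_eq_iff_eq_mul.1 hconj]
      simp only [mul_assoc]
    exact Subtype.ext (inv_mul_eq_one.1 (hfix _ (mul_mem (inv_mem d.2) c.2) hcomm)).symm

theorem isFrobeniusGroup_of_forall_commute [Finite R] [R.Normal] (h : R.IsComplement' L)
    (hL : L ≠ ⊥) (hR : R ≠ ⊥) (hfix : ∀ t : L, t ≠ 1 → ∀ k ∈ R, Commute k (t : G) → k = 1) :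
    IsFrobeniusGroup R L := by
  obtain ⟨f, hker, hf⟩ := exists_retraction_of_isComplement' h
  have hmem : ∀ g, g * (f g : G)⁻¹ ∈ R := fun g => by
    rw [← hker, MonoidHom.mem_ker, map_mul, map_inv, hf, mul_inv_cancel]
  refine ⟨hL, ?_, fun g hg => ?_, fun x => ⟨fun hx => or_iff_not_imp_right.2 fun hconj => ?_, ?_⟩⟩
  · rintro rfl
    exact hR (by simpa using h.disjoint)
  · refine (Subgroup.eq_bot_iff_forall _).2 ?_
    rintro _ ⟨hx, y, hy, rfl⟩
    by_contra hx1
    simp only [MulEquiv.coe_toMonoidHom, MulAut.conj_apply] at hx hx1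
    have hfx : g * y * g⁻¹ = f g * y * (f g)⁻¹ := by
      simpa [hf ⟨y, hy⟩] using congrArg Subtype.val (hf ⟨_, hx⟩).symm
    have hcomm : Commute (g * (f g : G)⁻¹) (g * y * g⁻¹) := by
      rw [commute_iff_eq]
      nth_rw 1 [hfx]
      simp [mul_assoc]
    have hg1 := hfix ⟨_, hx⟩ (fun h1 => hx1 (congrArg Subtype.val h1)) _ (hmem g) hcomm
    exact hg (mul_inv_eq_one.1 hg1 ▸ (f g).2)
  · push Not at hconj
    obtain ⟨g, y, hy, rfl⟩ := hconj
    have hy1 : y = 1 := by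
      rw [← hker, MonoidHom.mem_ker] at hx
      simpa [hf ⟨y, hy⟩] using hx
    simp [hy1]
  · rintro (rfl | hx)
    · exact one_mem R
    · by_contra hxR
      have hfx : f x ≠ 1 := by rwa [← hker] at hxR
      obtain ⟨c, -, hc⟩ := (forall_exists_conj_eq_mul_iff
        fun c hc => ‹R.Normal›.conj_mem c hc _).2 (hfix (f x) hfx) _ (hmem x)
      exact hx c ⟨f x, (f x).2, hc.trans (inv_mul_cancel_right _ _)⟩

theorem IsGCStar.eq_one_of_commute [Finite G] (hG : IsGCStar G) [R.Normal]
    (h : R.IsComplement' L) (hR : R ≤ commutator G) {t : L} (ht : t ∉ commutator L)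
    (hconj : ∀ l, t⁻¹ * l ∈ commutator L → IsConj t l) :
    ∀ k ∈ R, Commute k (t : G) → k = 1 := by
  obtain ⟨f, hker, hf⟩ := exists_retraction_of_isComplement' h
  have hcomm : ∀ l : L, (l : G) ∈ commutator G → l ∈ commutator L := fun l hl => by
    have hfl := Subgroup.mem_map_of_mem f hl
    rw [map_commutator_eq, hf] at hfl
    exact Subgroup.commutator_mono le_top le_top hfl
  rw [← forall_exists_conj_eq_mul_iff fun c hc => ‹R.Normal›.conj_mem c hc _]
  intro k hk
  have hkt : IsConj (t : G) (t * (t⁻¹ * k * t)) := by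
    refine hG.isConj_mul (mt (hcomm t) ht) t.2 (fun l hl htl => ?_) (hR ?_)
    · exact MonoidHom.map_isConj L.subtype (hconj ⟨l, hl⟩ (hcomm _ htl))
    · simpa using ‹R.Normal›.conj_mem k hk (t : G)⁻¹
  obtain ⟨g, hg⟩ := isConj_iff.1 hkt
  replace hg : g * t * g⁻¹ = k * t := by simpa [mul_assoc] using hg
  have hfg : f g * t * (f g)⁻¹ = t := by
    have hfk : f k = 1 := by rwa [← hker] at hk
    simpa [hf, hfk] using congrArg f hg
  refine ⟨g * (f g : G)⁻¹, ?_, ?_⟩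
  · rw [← hker, MonoidHom.mem_ker, map_mul, map_inv, hf, mul_inv_cancel]
  · have hfg' : (f g : G)⁻¹ * t * f g = t := congrArg Subtype.val (show (f g)⁻¹ * t * f g = t by
      rw [mul_assoc, inv_mul_eq_iff_eq_mul, ← mul_inv_eq_iff_eq_mul.1 hfg])
    calc g * (f g : G)⁻¹ * t * (g * (f g : G)⁻¹)⁻¹
        = g * ((f g : G)⁻¹ * t * f g) * g⁻¹ := by simp only [mul_inv_rev, inv_inv, mul_assoc]
      _ = k * t := by rw [hfg', hg]

theorem IsGCStar.eq_one_of_commute_of_isCyclic [Finite G] (hG : IsGCStar G) [R.Normal]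
    (h : R.IsComplement' L) (hR : R ≤ commutator G) [IsCyclic L] {t : L} (ht : t ≠ 1) :
    ∀ k ∈ R, Commute k (t : G) → k = 1 := by
  let _ : CommGroup L := IsCyclic.commGroup
  have hL : ∀ l ∈ commutator L, l = 1 := fun l hl => eq_one_of_mem_commutator (MonoidHom.id L) hl
  refine hG.eq_one_of_commute h hR (mt (hL t) ht) fun l hl => ?_
  rw [inv_mul_eq_one.1 (hL _ hl)]

theorem conj_eq_inv_of_forall_commute [Finite R] [R.Normal] {w : G}
    (hfix : ∀ k ∈ R, Commute k w → k = 1) {c : G} (hc : c ∈ R) (hcw : Commute c (w * w)) :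
    w * c * w⁻¹ = c⁻¹ := by
  have hw : w ∈ Subgroup.centralizer {w * w} :=
    Subgroup.mem_centralizer_singleton_iff.2 (mul_assoc w w w).symm
  have : Finite (R ⊓ Subgroup.centralizer {w * w} : Subgroup G) :=
    Finite.of_injective _ (Subgroup.inclusion_injective inf_le_left)
  have hcent : ∀ x ∈ Subgroup.centralizer {w * w},
      w * x * w⁻¹ ∈ Subgroup.centralizer {w * w} := fun x hx =>
    (Subgroup.centralizer {w * w}).mul_mem (mul_mem hw hx) (inv_mem hw)
  obtain ⟨d, ⟨-, hdw⟩, hd⟩ := (forall_exists_conj_eq_mul_iff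
    (R := R ⊓ Subgroup.centralizer {w * w}) (t := w) fun x hx =>
      ⟨‹R.Normal›.conj_mem x hx.1 w, hcent x hx.2⟩).2
    (fun k hk => hfix k hk.1) c ⟨hc, Subgroup.mem_centralizer_singleton_iff.2 hcw.eq⟩
  obtain rfl : c = d * w * d⁻¹ * w⁻¹ := eq_mul_inv_of_mul_eq hd.symm
  have hdww : w * w * d⁻¹ = d⁻¹ * (w * w) :=
    (Subgroup.mem_centralizer_singleton_iff.1 (inv_mem hdw)).symm
  calc w * (d * w * d⁻¹ * w⁻¹) * w⁻¹
      = w * d * w⁻¹ * (w * w * d⁻¹) * (w * w)⁻¹ := by group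
    _ = (d * w * d⁻¹ * w⁻¹)⁻¹ := by rw [hdww]; group

theorem commutator_quaternionGroup_two_le_center :
    commutator (QuaternionGroup 2) ≤ Subgroup.center (QuaternionGroup 2) := by
  simp only [commutator_def, Subgroup.commutator_le, Subgroup.mem_center_iff, Subgroup.mem_top,
    forall_const]
  decide

theorem isConj_of_inv_mul_mem_center_quaternionGroup_two {x y : QuaternionGroup 2}
    (hx : x ∉ Subgroup.center (QuaternionGroup 2))
    (hxy : x⁻¹ * y ∈ Subgroup.center (QuaternionGroup 2)) : IsConj x y := by
  simp only [Subgroup.mem_center_iff] at hx hxy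
  rw [isConj_iff]
  revert x y
  decide

theorem exists_mul_self_eq_quaternionGroup_two {z : QuaternionGroup 2}
    (hz : z ∈ Subgroup.center (QuaternionGroup 2)) (hz1 : z ≠ 1) :
    ∃ i ∉ Subgroup.center (QuaternionGroup 2), ∃ j ∉ Subgroup.center (QuaternionGroup 2),
      i * j ∉ Subgroup.center (QuaternionGroup 2) ∧ i * i = z ∧ j * j = z := by
  simp only [Subgroup.mem_center_iff] at hz ⊢
  revert z
  decide

theorem IsGCStar.eq_one_of_commute_of_notMem_center [Finite G] (hG : IsGCStar G) [R.Normal]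
    (h : R.IsComplement' L) (hR : R ≤ commutator G) (e : L ≃* QuaternionGroup 2)
    {q : QuaternionGroup 2} (hq : q ∉ Subgroup.center (QuaternionGroup 2)) :
    ∀ k ∈ R, Commute k (e.symm q : G) → k = 1 := by
  have hcenter : ∀ l ∈ commutator L, e l ∈ Subgroup.center (QuaternionGroup 2) := fun l hl => by
    have hel := Subgroup.mem_map_of_mem e.toMonoidHom hl
    rw [map_commutator_eq] at hel
    exact commutator_quaternionGroup_two_le_center (Subgroup.commutator_mono le_top le_top hel)
  refine hG.eq_one_of_commute h hR (fun hmem => hq ?_) fun l hl => ?_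
  · simpa using hcenter _ hmem
  · have hconj : IsConj q (e l) :=
      isConj_of_inv_mul_mem_center_quaternionGroup_two hq (by simpa using hcenter _ hl)
    simpa using MonoidHom.map_isConj e.symm.toMonoidHom hconj

theorem IsGCStar.eq_one_of_commute_of_mulEquiv_quaternionGroup [Finite G] (hG : IsGCStar G)
    [R.Normal] (h : R.IsComplement' L) (hR : R ≤ commutator G) (e : L ≃* QuaternionGroup 2)
    {t : L} (ht : t ≠ 1) : ∀ k ∈ R, Commute k (t : G) → k = 1 := by
  obtain ⟨q, rfl⟩ := e.symm.surjective t
  have hfix := fun q => hG.eq_one_of_commute_of_notMem_center h hR e (q := q)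
  by_cases hq : q ∈ Subgroup.center (QuaternionGroup 2)
  · obtain ⟨i, hi, j, hj, hij, hii, hjj⟩ :=
      exists_mul_self_eq_quaternionGroup_two hq (by rintro rfl; exact ht (map_one _))
    have hinv : ∀ w ∉ Subgroup.center (QuaternionGroup 2), w * w = q → ∀ k ∈ R,
        Commute k (e.symm q : G) → e.symm w * k * (e.symm w : G)⁻¹ = k⁻¹ := by
      rintro w hw rfl k hk hkw
      exact conj_eq_inv_of_forall_commute (hfix w hw) hk (by simpa using hkw)
    -- Both `i` and `j` invert `k`, so `i * j` centralizes it.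
    intro k hk hkq
    refine hfix _ hij k hk ?_
    have hi_inv := hinv i hi hii k hk hkq
    have hj_inv := hinv j hj hjj k hk hkq
    have hfixed : e.symm (i * j) * k * (e.symm (i * j) : G)⁻¹ = k :=
      calc (e.symm (i * j) * k * (e.symm (i * j) : G)⁻¹ : G)
          = e.symm i * (e.symm j * k * (e.symm j : G)⁻¹) * (e.symm i : G)⁻¹ := by
            simp only [map_mul, Subgroup.coe_mul]; group
        _ = (e.symm i * k * (e.symm i : G)⁻¹)⁻¹ := by rw [hj_inv]; group
        _ = k := by rw [hi_inv, inv_inv]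
    exact (mul_inv_eq_iff_eq_mul.1 hfixed).symm
  · exact hfix q hq

end FrobeniusGroups

theorem IsGCStar.isCyclic_or_nonempty_mulEquiv_of_isComplement' {G : Type*} [Group G] [Finite G]
    [Group.IsSolvable G] (hG : IsGCStar G) (hR : nilpotentResidual G ≠ ⊥) {L : Subgroup G}
    (hL : (nilpotentResidual G).IsComplement' L) :
    IsCyclic L ∨ Nonempty (L ≃* QuaternionGroup 2) := by
  obtain ⟨f, -, hf⟩ := exists_retraction_of_isComplement' hL
  have : Group.IsNilpotent (G ⧸ nilpotentResidual G) := (isNilpotent_quotient_iff _).2 le_rfl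
  have : Group.IsNilpotent L := Group.nilpotent_of_mulEquiv hL.symm.QuotientMulEquiv
  have hGL : IsGCStar L := hG.of_surjective (f := f) fun l => ⟨l, hf l⟩
  refine hGL.isCyclic_or_nonempty_mulEquiv fun B hB => ?_
  have : IsCyclic (B.map L.subtype) :=
    hG.isCyclic_of_le_complement hR hL (Subgroup.map_subtype_le B)
  exact (B.equivMapOfInjective L.subtype L.subtype_injective).isCyclic.2 this

theorem proposition3p4 (G : Type*) [Group G] [Finite G] (hsolv : Group.IsSolvable G)
    (hnil : ¬ Group.IsNilpotent G) (hG : IsGCStar G) :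
    ∃ L : Subgroup G,
      IsFrobeniusGroup (nilpotentResidual G) L ∧
      (nilpotentResidual G).IsComplement' L ∧
      (IsCyclic L ∨ Nonempty (L ≃* QuaternionGroup 2)) := by
  have hR : nilpotentResidual G ≠ ⊥ := mt isNilpotent_iff_nilpotentResidual_eq_bot.2 hnil
  have : Nontrivial G := not_subsingleton_iff_nontrivial.1 fun _ => hR (Subsingleton.elim _ _)
  obtain ⟨L, hL⟩ := Subgroup.exists_right_complement'_of_coprime
    hG.coprime_card_index_nilpotentResidual
  have hLtype := hG.isCyclic_or_nonempty_mulEquiv_of_isComplement' hR hL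
  have hL_ne_bot : L ≠ ⊥ := by
    rintro rfl
    exact nilpotentResidual_ne_top (Subgroup.isComplement'_bot_right.1 hL)
  refine ⟨L, isFrobeniusGroup_of_forall_commute hL hL_ne_bot hR fun t ht => ?_, hL, hLtype⟩
  rcases hLtype with hcyclic | ⟨⟨e⟩⟩
  · exact hG.eq_one_of_commute_of_isCyclic hL nilpotentResidual_le_commutator ht
  · exact hG.eq_one_of_commute_of_mulEquiv_quaternionGroup hL nilpotentResidual_le_commutator e ht
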